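/- Setting. Consider a convolutional layer of a CNN (stride one, zero padding, $n$ output channels of size $w\times h$, any activation) and an input $z$ of that layer. Let $x_1,\dots,x_n\in\mathbb{R}^{d}$, $d=wh$, be its vectorised output feature maps at initialisation. The CNN is approximated by the two-layer ReLU network $f(W,a,x)=\frac1{\sqrt m}\sum_{r=1}^m a_r\max(w_r^{T}x,0)$ whose data samples are the channels $x_c$: its outputs are $u^\phi_c(t)=f(W(t),a,x_c)$. The labels are $y\in\mathbb{R}^n$, the vector $a$ is fixed, and $W(t)$, $t\ge 0$, is trained by gradient descent with infinitely small step size (gradient flow) on the loss $\frac12\sum_c (f(W,a,x_c)-y_c)^2$, where at its kink ReLU may be given any derivative in $[0,1]$, measurably in time; the inequality below is claimed for every such trajectory. Let $H^\infty_{ij}=\mathbb{E}_{w\sim\mathcal N(0,I)}[x_i^Tx_j\,\mathbb{I}\{w^Tx_i\ge0,\,w^Tx_j\ge0\}]$. The singular values of a matrix $X$ with $n$ columns are the square roots of the $n$ eigenvalues of $X^TX$, and $c(X)=\sigma_{\max}(X)/\sigma_{\min}(X)\in[1,\infty]$ is its condition number ($1/c(X)^2=0$ if $c(X)=\infty$).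 A scaled feature matrix $X^\phi(0)$ is either the matrix with columns $x_c/\sqrt2$, or any matrix $X$ with $X^TX=H^\infty$ (so that $\sigma_k(X)=\sqrt{\lambda_k(H^\infty)}$); in both cases its squared column norms are the diagonal entries $\|x_c\|^2/2$ of $H^\infty$. Theorem. For all constants $c_{low},c_{high},C$ there is a constant $K>0$, depending only on them, such that the following holds for all such layers and inputs, all $n,m,w,h$, all $y$ and all $\delta\in(0,1)$. Suppose $c_{low}<\|x_c\|_2<c_{high}$ and $|y_c|<C$ for all $c$, $\lambda_{\min}(H^\infty)>0$, and $m\ge K\,\frac{n^6}{\lambda_{\min}(H^\infty)^4\delta^6}$. Let $w_r(0)\sim\mathcal N(0,I)$ and $a_r$ uniform on $\{-1,1\}$, $r=1,\dots,m$, all independent. Then with probability at least $1-\delta$ the following holds for every scaled feature matrix $X^\phi(0)$ with $\sigma_{\max}(X^\phi(0))\ge1$ and all $t\ge0$: $$\|u^\phi(t)-y\|_2^2\le\exp\!\left(-\frac{t}{c(X^\phi(0))^2}\right)\|u^\phi(0)-y\|_2^2 .$$ -/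

import Mathlib

open MeasureTheory ProbabilityTheory
open scoped Matrix ENNReal

noncomputable section

namespace CNN

/-! ### The two-layer ReLU network -/

section Network

variable {E : Type*} [NormedAddCommGroup E] [InnerProductSpace ℝ E]

/-- The ReLU activation function. -/
def relu (z : ℝ) : ℝ := max z 0

/-- The (Clarke) subdifferential of ReLU: `{0}` for `z < 0`, `{1}` for `0 < z`, `[0, 1]` for
`z = 0`. In particular the indicator of `0 ≤ z` always belongs to it. -/
def reluSubdiff (z : ℝ) : Set ℝ :=
  {s | 0 ≤ s ∧ s ≤ 1 ∧ (0 < z → s = 1) ∧ (z < 0 → s = 0)}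

/-- The network `f(W, a, x) = (1/√m) ∑ᵣ aᵣ σ(⟨wᵣ, x⟩)` with `m` hidden nodes. -/
def twoLayerNet {m : ℕ} (W : Fin m → E) (a : Fin m → ℝ) (x : E) : ℝ :=
  (1 / √(m : ℝ)) * ∑ r, a r * relu (inner ℝ (W r) x)

/-- The gradient with respect to `wᵣ` of the loss `∑ᵢ ½ (f(W, a, xᵢ) - yᵢ)²`, where `s r i` is the
value taken for the derivative of ReLU at `⟨wᵣ, xᵢ⟩`. -/
def lossGradient {m n : ℕ} (x : Fin n → E) (y : Fin n → ℝ) (a : Fin m → ℝ) (W : Fin m → E)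
    (s : Fin m → Fin n → ℝ) (r : Fin m) : E :=
  ∑ i, ((1 / √(m : ℝ)) * (twoLayerNet W a (x i) - y i) * a r * s r i) • x i

/-- `W` is trained by gradient descent with infinitely small step size, with `a` fixed: it is an
absolutely continuous solution on `[0, ∞)` of `W' = - ∇ loss`, written in integral form.
As ReLU has no derivative at `0`, any measurable choice from its subdifferential is allowed there;
the choice `σ'(z) = 𝟙{0 ≤ z}` is a special case. -/
def IsGradientFlow {m n : ℕ} (x : Fin n → E) (y : Fin n → ℝ) (a : Fin m → ℝ)
    (W : ℝ → Fin m → E) : Prop :=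
  ContinuousOn W (Set.Ici 0) ∧
  ∃ s : ℝ → Fin m → Fin n → ℝ,
    (∀ r i, Measurable fun t => s t r i) ∧
    (∀ t, 0 ≤ t → ∀ r i, s t r i ∈ reluSubdiff (inner ℝ (W t r) (x i))) ∧
    ∀ t, 0 ≤ t → ∀ r, W t r = W 0 r - ∫ τ in (0 : ℝ)..t, lossGradient x y a (W τ) (s τ) r

variable [FiniteDimensional ℝ E] [MeasurableSpace E] [BorelSpace E]

/-- The Gram matrix `H^∞` with entries
`𝔼_{w ∼ N(0, I)} [⟨xᵢ, xⱼ⟩ 𝟙{⟨w, xᵢ⟩ ≥ 0, ⟨w, xⱼ⟩ ≥ 0}]`. -/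
def gramInfinity {n : ℕ} (x : Fin n → E) : Matrix (Fin n) (Fin n) ℝ :=
  Matrix.of fun i j =>
    ∫ w, (if 0 ≤ (inner ℝ w (x i) : ℝ) ∧ 0 ≤ (inner ℝ w (x j) : ℝ)
      then (inner ℝ (x i) (x j) : ℝ) else 0) ∂(stdGaussian E)

/-- The uniform distribution on `{-1, 1}`. -/
def uniformSign : Measure ℝ :=
  (2⁻¹ : ℝ≥0∞) • Measure.dirac 1 + (2⁻¹ : ℝ≥0∞) • Measure.dirac (-1)

/-- The law of the initialisation `(W(0), a)`: all `wᵣ ∼ N(0, I)` and all `aᵣ` uniform on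
`{-1, 1}`, independent. -/
def initLaw (E : Type*) [NormedAddCommGroup E] [InnerProductSpace ℝ E] [FiniteDimensional ℝ E]
    [MeasurableSpace E] [BorelSpace E] (m : ℕ) : Measure ((Fin m → E) × (Fin m → ℝ)) :=
  (Measure.pi fun _ => stdGaussian E).prod (Measure.pi fun _ => uniformSign)

end Network

/-! ### Eigenvalues, singular values, condition number -/

/-- The smallest eigenvalue (used for symmetric matrices of positive size). -/
def lambdaMin {n : ℕ} (A : Matrix (Fin n) (Fin n) ℝ) : ℝ := sInf (spectrum ℝ A)

/-- The largest eigenvalue (used for symmetric matrices of positive size). -/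
def lambdaMax {n : ℕ} (A : Matrix (Fin n) (Fin n) ℝ) : ℝ := sSup (spectrum ℝ A)

/-- The largest singular value; the singular values of a matrix with `n` columns are the square
roots of the `n` eigenvalues of `Xᵀ X`. -/
def sigmaMax {ι : Type*} [Fintype ι] {n : ℕ} (X : Matrix ι (Fin n) ℝ) : ℝ :=
  √(lambdaMax (Xᵀ * X))

/-- The smallest singular value. -/
def sigmaMin {ι : Type*} [Fintype ι] {n : ℕ} (X : Matrix ι (Fin n) ℝ) : ℝ :=
  √(lambdaMin (Xᵀ * X))

/-- The condition number `σ_max / σ_min`, which is `∞` if the columns of `X ≠ 0` are linearly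
dependent. -/
def condNumber {ι : Type*} [Fintype ι] {n : ℕ} (X : Matrix ι (Fin n) ℝ) : ℝ≥0∞ :=
  ENNReal.ofReal (sigmaMax X) / ENNReal.ofReal (sigmaMin X)

/-! ### The convolutional layer -/

/-- Extension of a `w × h` image by zero. -/
def zeroPad {w h : ℕ} (z : Fin w → Fin h → ℝ) (i j : ℤ) : ℝ :=
  if H : (0 ≤ i ∧ i < w) ∧ (0 ≤ j ∧ j < h) then
    z ⟨i.toNat, by omega⟩ ⟨j.toNat, by omega⟩
  else 0

/-- A convolutional layer with `cin` input channels, `n` output channels, kernels of odd size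
`2 p + 1`, and an activation function (possibly the identity). -/
structure ConvLayer (cin n p : ℕ) where
  kernel : Fin n → Fin cin → Fin (2 * p + 1) → Fin (2 * p + 1) → ℝ
  act : ℝ → ℝ

/-- The space of vectorised `w × h` feature maps. -/
abbrev FeatureSpace (w h : ℕ) : Type := EuclideanSpace ℝ (Fin w × Fin h)

/-- The `c`-th output feature map (stride one, zero padding) on the input `z`, vectorised:
the entry at `(i, j)` is the activation of
`∑_k ∑_{a, b = -p}^{p} kernel c k (a + p) (b + p) * z k (i + a) (j + b)`. -/
def ConvLayer.featureMap {cin n p w h : ℕ} (l : ConvLayer cin n p)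
    (z : Fin cin → Fin w → Fin h → ℝ) (c : Fin n) : FeatureSpace w h :=
  WithLp.toLp 2 fun q : Fin w × Fin h =>
    l.act (∑ k, ∑ a : Fin (2 * p + 1), ∑ b : Fin (2 * p + 1),
      l.kernel c k a b *
        zeroPad (z k) ((q.1 : ℤ) + ((a : ℤ) - p)) ((q.2 : ℤ) + ((b : ℤ) - p)))

/-- The scaled feature matrix: its columns are the vectorised feature maps, scaled by `1/√2`, so
that its squared column norms `‖x c‖² / 2` are the diagonal entries of `gramInfinity x`. -/
def scaledFeatureMatrix {w h n : ℕ} (x : Fin n → FeatureSpace w h) :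
    Matrix (Fin w × Fin h) (Fin n) ℝ :=
  Matrix.of fun q c => (1 / √2) * x c q

/-- Output vector of the network that approximates the CNN: the two-layer network whose data
samples are the channels (vectorised feature maps) of the layer. -/
def output {w h n m : ℕ} (x : Fin n → FeatureSpace w h) (W : Fin m → FeatureSpace w h)
    (a : Fin m → ℝ) : EuclideanSpace ℝ (Fin n) :=
  WithLp.toLp 2 fun c => twoLayerNet W a (x c)

end CNN

end

namespace CNN

/-! ### Absolutely continuous functions -/

/-! Along the flow the squared error has derivative `-2 ∑ᵣ ‖∇ᵣ‖²` at almost every time, and `∑ᵣ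
‖∇ᵣ‖²` is the quadratic form of `kernelMatrix` at the residual (`ae_hasDerivAt_sqError`,
`dotProduct_kernelMatrix_mulVec`). The choice of derivative at a kink is harmless: if a ReLU
composition is differentiable while its argument is zero, the argument has zero velocity there.

With `lam` the least eigenvalue of `gramInfinity`, it suffices that the kernel form stays at least
`lam / 2` times the squared norm. At initialisation the kernel is an average of independent matrices
with mean `gramInfinity`. While every weight stays within `R` of its start, only neurons initially
close to a kink can change their derivative, and these are few because a Gaussian projection has
bounded density (`kernelMatrix_coercive`). Conversely, exponential decay of the error makes the
total path of each weight `O(1/√m)`, below `R` for large `m`. A first-exit-time argument closes this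
loop (`sqError_le_exp_of_isGradientFlow`). Chebyshev and Markov bounds give the required initial
events (`exists_good_initialisation`).

This yields decay at rate `lam`. Since `σ_max ≥ 1`, the rate `1/c²` is at most `σ_min²`. That is
`lam` when `Xᵀ X` is the Gram matrix. For the feature matrix it is at most `lam`, because each
neuron is active with probability at least one half (`mul_le_dotProduct_gramInfinity`). -/

theorem hasDerivAt_relu_comp {z : ℝ → ℝ} {t z' s : ℝ} (hz : HasDerivAt z z' t)
    (hr : DifferentiableAt ℝ (fun τ => relu (z τ)) t) (hs : s ∈ reluSubdiff (z t)) :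
    HasDerivAt (fun τ => relu (z τ)) (s * z') t := by
  obtain ⟨-, -, h1, h0⟩ := hs
  rcases lt_trichotomy (z t) 0 with h | h | h
  · rw [h0 h, zero_mul]
    refine (hasDerivAt_const t (0 : ℝ)).congr_of_eventuallyEq ?_
    filter_upwards [hz.continuousAt.eventually_lt_const h] with τ hτ
    simp [relu, hτ.le]
  · -- Both `relu ∘ z` and `relu ∘ (-z)` have a minimum at `t`, so `z' = 0`.
    have hmin : IsLocalMin (fun τ => relu (z τ)) t :=
      Filter.Eventually.of_forall fun τ => by simp [relu, h]
    have hmin' : IsLocalMin (fun τ => relu (z τ) - z τ) t :=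
      Filter.Eventually.of_forall fun τ => by simp [relu, h]
    have h1 := hmin.hasDerivAt_eq_zero hr.hasDerivAt
    have h2 := hmin'.hasDerivAt_eq_zero (hr.hasDerivAt.sub hz)
    have h3 : z' = 0 := by linarith
    rw [h3, mul_zero]
    exact h1 ▸ hr.hasDerivAt
  · rw [h1 h, one_mul]
    refine hz.congr_of_eventuallyEq ?_
    filter_upwards [hz.continuousAt.eventually_const_lt h] with τ hτ
    simp [relu, hτ.le]

/-- The fundamental theorem of calculus for absolutely continuous functions. It is needed because
derivatives along the flow are controlled only at almost every time. -/
theorem le_of_ae_hasDerivAt_nonpos {f : ℝ → ℝ} {a b : ℝ} (hab : a ≤ b)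
    (hf : AbsolutelyContinuousOnInterval f a b)
    (h : ∀ᵐ t, t ∈ Set.Ioo a b → ∃ d ≤ 0, HasDerivAt f d t) : f b ≤ f a := by
  have h1 := hf.integral_deriv_eq_sub
  have h2 : 0 ≤ ∫ t in a..b, -deriv f t := by
    rw [intervalIntegral.integral_of_le hab, ← integral_Ioc_eq_integral_Ioo.symm]
    refine setIntegral_nonneg_of_ae_restrict ?_
    filter_upwards [(ae_restrict_iff' measurableSet_Ioo).2 h] with t ht
    obtain ⟨d, hd, hd'⟩ := ht
    rw [hd'.deriv]
    simpa using hd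
  rw [intervalIntegral.integral_neg] at h2
  linarith

theorem absolutelyContinuousOnInterval_sum {ι : Type*} (s : Finset ι) {f : ι → ℝ → ℝ} {a b : ℝ}
    (hf : ∀ i ∈ s, AbsolutelyContinuousOnInterval (f i) a b) :
    AbsolutelyContinuousOnInterval (fun t => ∑ i ∈ s, f i t) a b := by
  classical
  induction s using Finset.induction_on with
  | empty =>
    simpa using (LipschitzWith.const (0 : ℝ)).lipschitzOnWith.absolutelyContinuousOnInterval
  | insert i s hi ih =>
    simp only [Finset.sum_insert hi]
    exact (hf i (Finset.mem_insert_self i s)).add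
      (ih fun j hj => hf j (Finset.mem_insert_of_mem hj))

/-! ### Gradient flow: energy dissipation, decay and confinement of the weights. -/

section Flow

variable {E : Type*} [NormedAddCommGroup E] [InnerProductSpace ℝ E] {m n : ℕ}

/-- The sum of the squared errors of the network. -/
noncomputable def sqError (x : Fin n → E) (y : Fin n → ℝ) (a : Fin m → ℝ) (W : Fin m → E) : ℝ :=
  ∑ i, (twoLayerNet W a (x i) - y i) ^ 2

theorem sqError_nonneg (x : Fin n → E) (y : Fin n → ℝ) (a : Fin m → ℝ) (W : Fin m → E) :
    0 ≤ sqError x y a W :=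
  Finset.sum_nonneg fun _ _ => sq_nonneg _

theorem lossGradient_eq_smul (x : Fin n → E) (y : Fin n → ℝ) (a : Fin m → ℝ) (W : Fin m → E)
    (s : Fin m → Fin n → ℝ) (r : Fin m) :
    lossGradient x y a W s r =
      (1 / √(m : ℝ) * a r) • ∑ i, ((twoLayerNet W a (x i) - y i) * s r i) • x i := by
  rw [lossGradient, Finset.smul_sum]
  refine Finset.sum_congr rfl fun i _ => ?_
  rw [smul_smul]
  congr 1
  ring

theorem norm_sq_lossGradient {x : Fin n → E} {y : Fin n → ℝ} {a : Fin m → ℝ} {W : Fin m → E}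
    {s : Fin m → Fin n → ℝ} (r : Fin m) (ha : a r ^ 2 = 1) :
    ‖lossGradient x y a W s r‖ ^ 2 =
      1 / (m : ℝ) * ‖∑ i, ((twoLayerNet W a (x i) - y i) * s r i) • x i‖ ^ 2 := by
  rw [lossGradient_eq_smul, norm_smul, mul_pow, Real.norm_eq_abs, sq_abs, mul_pow, ha, div_pow,
    Real.sq_sqrt (Nat.cast_nonneg m), one_pow, mul_one]

/-- Triangle inequality, then Cauchy–Schwarz to pass from the `ℓ¹` to the `ℓ²` norm of the residual.
The factor `1/√m` is what keeps individual weights almost still in a wide network. -/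
theorem norm_lossGradient_le {x : Fin n → E} {y : Fin n → ℝ} {a : Fin m → ℝ} {W : Fin m → E}
    {s : Fin m → Fin n → ℝ} {M : ℝ} (hM : ∀ i, ‖x i‖ ≤ M) (r : Fin m) (ha : a r ^ 2 = 1)
    (hs : ∀ i, |s r i| ≤ 1) :
    ‖lossGradient x y a W s r‖ ≤ M * √n / √m * √(sqError x y a W) := by
  have habs : |a r| = 1 := by
    rw [← sq_abs] at ha
    exact (pow_eq_one_iff_of_nonneg (abs_nonneg _) two_ne_zero).1 ha
  have h1 : ‖∑ i, ((twoLayerNet W a (x i) - y i) * s r i) • x i‖ ≤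
      ∑ i, |twoLayerNet W a (x i) - y i| * M := by
    refine norm_sum_le_of_le _ fun i _ => ?_
    rw [norm_smul, Real.norm_eq_abs, abs_mul]
    refine mul_le_mul ?_ (hM i) (norm_nonneg _) (abs_nonneg _)
    exact mul_le_of_le_one_right (abs_nonneg _) (hs i)
  have h2 : ∑ i, |twoLayerNet W a (x i) - y i| ≤ √n * √(sqError x y a W) := by
    rw [← Real.sqrt_mul (Nat.cast_nonneg n)]
    refine Real.le_sqrt_of_sq_le ?_
    have := sq_sum_le_card_mul_sum_sq (s := (Finset.univ : Finset (Fin n)))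
      (f := fun i => |twoLayerNet W a (x i) - y i|)
    simpa [sq_abs, sqError] using this
  rw [lossGradient_eq_smul, norm_smul, Real.norm_eq_abs, abs_mul, habs, mul_one,
    abs_of_nonneg (by positivity)]
  -- The sign of `M` is known only through a sample, so the empty sample set is separate.
  rcases Nat.eq_zero_or_pos n with rfl | hn
  · simp
  have hM0 : 0 ≤ M := (norm_nonneg _).trans (hM ⟨0, hn⟩)
  rw [← Finset.sum_mul] at h1
  calc 1 / √(m : ℝ) * ‖∑ i, ((twoLayerNet W a (x i) - y i) * s r i) • x i‖
      ≤ 1 / √(m : ℝ) * (√n * √(sqError x y a W) * M) := by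
        gcongr
        exact h1.trans (by gcongr)
    _ = _ := by ring

theorem continuousOn_twoLayerNet {a : Fin m → ℝ} {W : ℝ → Fin m → E} {S : Set ℝ}
    (hW : ContinuousOn W S) (v : E) : ContinuousOn (fun t => twoLayerNet (W t) a v) S := by
  unfold twoLayerNet relu
  have h : ∀ r, ContinuousOn (fun t => W t r) S := fun r => (continuous_apply r).comp_continuousOn hW
  have h' : ∀ r, ContinuousOn (fun t => (inner ℝ (W t r) v : ℝ)) S := fun r =>
    (h r).inner continuousOn_const
  fun_prop

theorem continuousOn_sqError {x : Fin n → E} {y : Fin n → ℝ} {a : Fin m → ℝ} {W : ℝ → Fin m → E}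
    {S : Set ℝ} (hW : ContinuousOn W S) : ContinuousOn (fun t => sqError x y a (W t)) S := by
  unfold sqError
  have h := fun i => continuousOn_twoLayerNet (a := a) hW (x i)
  fun_prop

variable {x : Fin n → E} {y : Fin n → ℝ} {a : Fin m → ℝ} {W : ℝ → Fin m → E}
  {s : ℝ → Fin m → Fin n → ℝ}

/-- A qualitative bound from compactness, enough to make the weights Lipschitz on bounded time
intervals. The quantitative drift bound is `norm_weights_sub_le`. -/
theorem exists_norm_lossGradient_le (ha : ∀ r, a r ^ 2 = 1) (hW : ContinuousOn W (Set.Ici 0))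
    (hs : ∀ t, 0 ≤ t → ∀ r i, s t r i ∈ reluSubdiff (inner ℝ (W t r) (x i))) (T : ℝ) :
    ∃ L : ℝ, 0 ≤ L ∧ ∀ t ∈ Set.Icc 0 T, ∀ r, ‖lossGradient x y a (W t) (s t) r‖ ≤ L := by
  obtain ⟨D, hD⟩ := isCompact_Icc.exists_bound_of_continuousOn
    (continuousOn_sqError (x := x) (y := y) (a := a) (hW.mono (fun t (ht : t ∈ Set.Icc 0 T) => ht.1)))
  have hM : ∀ i, ‖x i‖ ≤ ∑ j, ‖x j‖ := fun i =>
    Finset.single_le_sum (f := fun j => ‖x j‖) (fun _ _ => norm_nonneg _) (Finset.mem_univ i)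
  have hM0 : 0 ≤ ∑ j, ‖x j‖ := Finset.sum_nonneg fun _ _ => norm_nonneg _
  refine ⟨(∑ j, ‖x j‖) * √n / √m * √D, by positivity, fun t ht r => ?_⟩
  refine (norm_lossGradient_le hM r (ha r) fun i => ?_).trans ?_
  · obtain ⟨h0, h1, -⟩ := hs t ht.1 r i
    exact abs_le.2 ⟨by linarith, h1⟩
  · gcongr
    exact (le_abs_self _).trans (hD t ht)

theorem intervalIntegrable_lossGradient (ha : ∀ r, a r ^ 2 = 1) (hW : ContinuousOn W (Set.Ici 0))
    (hsm : ∀ r i, Measurable fun t => s t r i)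
    (hs : ∀ t, 0 ≤ t → ∀ r i, s t r i ∈ reluSubdiff (inner ℝ (W t r) (x i))) {T : ℝ} (hT : 0 ≤ T)
    (r : Fin m) :
    IntervalIntegrable (fun t => lossGradient x y a (W t) (s t) r) volume 0 T := by
  obtain ⟨L, -, hL⟩ := exists_norm_lossGradient_le (y := y) ha hW hs T
  rw [intervalIntegrable_iff, Set.uIoc_of_le hT]
  refine IntegrableOn.of_bound measure_Ioc_lt_top ?_ L ?_
  · unfold lossGradient
    refine Finset.aestronglyMeasurable_fun_sum _ fun i _ => ?_
    refine AEStronglyMeasurable.smul_const ?_ _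
    refine AEStronglyMeasurable.mul ?_ (hsm r i).aestronglyMeasurable
    refine ContinuousOn.aestronglyMeasurable ?_ measurableSet_Ioc
    have h := continuousOn_twoLayerNet (a := a) (hW.mono (fun t (ht : t ∈ Set.Ioc 0 T) => ht.1.le))
      (x i)
    fun_prop
  · filter_upwards [self_mem_ae_restrict measurableSet_Ioc] with t ht
    exact hL t ⟨ht.1.le, ht.2⟩ r

theorem lipschitzOnWith_weights (ha : ∀ r, a r ^ 2 = 1) (hW : ContinuousOn W (Set.Ici 0))
    (hsm : ∀ r i, Measurable fun t => s t r i)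
    (hs : ∀ t, 0 ≤ t → ∀ r i, s t r i ∈ reluSubdiff (inner ℝ (W t r) (x i)))
    (hflow : ∀ t, 0 ≤ t → ∀ r,
      W t r = W 0 r - ∫ τ in (0 : ℝ)..t, lossGradient x y a (W τ) (s τ) r) {T : ℝ} :
    ∃ L : NNReal, ∀ r, LipschitzOnWith L (fun t => W t r) (Set.Icc 0 T) := by
  obtain ⟨L, hL0, hL⟩ := exists_norm_lossGradient_le (y := y) ha hW hs T
  refine ⟨⟨L, hL0⟩, fun r => LipschitzOnWith.of_dist_le_mul fun t ht t' ht' => ?_⟩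
  have hI := fun {T : ℝ} (hT : 0 ≤ T) =>
    intervalIntegrable_lossGradient (y := y) ha hW hsm hs hT r
  rw [dist_eq_norm, hflow t ht.1, hflow t' ht'.1, sub_sub_sub_cancel_left,
    intervalIntegral.integral_interval_sub_left (hI ht'.1) (hI ht.1), dist_comm, Real.dist_eq]
  refine intervalIntegral.norm_integral_le_of_norm_le_const fun τ hτ => hL τ ?_ r
  exact Set.uIcc_subset_Icc ht ht' (Set.uIoc_subset_uIcc hτ)

theorem ae_hasDerivAt_weights [CompleteSpace E] (ha : ∀ r, a r ^ 2 = 1)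
    (hW : ContinuousOn W (Set.Ici 0)) (hsm : ∀ r i, Measurable fun t => s t r i)
    (hs : ∀ t, 0 ≤ t → ∀ r i, s t r i ∈ reluSubdiff (inner ℝ (W t r) (x i)))
    (hflow : ∀ t, 0 ≤ t → ∀ r,
      W t r = W 0 r - ∫ τ in (0 : ℝ)..t, lossGradient x y a (W τ) (s τ) r) {T : ℝ} (hT : 0 ≤ T) :
    ∀ᵐ t, t ∈ Set.Ioo 0 T → ∀ r,
      HasDerivAt (fun τ => W τ r) (-lossGradient x y a (W t) (s t) r) t := by
  have h : ∀ᵐ t, ∀ r, t ∈ Set.uIcc 0 T → ∀ c ∈ Set.uIcc 0 T,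
      HasDerivAt (fun t => ∫ τ in c..t, lossGradient x y a (W τ) (s τ) r)
        (lossGradient x y a (W t) (s t) r) t :=
    ae_all_iff.2 fun r =>
      (intervalIntegrable_lossGradient (y := y) ha hW hsm hs hT r).ae_hasDerivAt_integral
  filter_upwards [h] with t ht htT r
  rw [Set.uIcc_of_le hT] at ht
  refine ((ht r (Set.Ioo_subset_Icc_self htT) 0 ⟨le_rfl, hT⟩).const_sub (W 0 r)
    ).congr_of_eventuallyEq ?_
  filter_upwards [Ioi_mem_nhds htT.1] with τ hτ
  exact hflow τ (le_of_lt hτ) r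

theorem absolutelyContinuousOnInterval_relu (ha : ∀ r, a r ^ 2 = 1)
    (hW : ContinuousOn W (Set.Ici 0)) (hsm : ∀ r i, Measurable fun t => s t r i)
    (hs : ∀ t, 0 ≤ t → ∀ r i, s t r i ∈ reluSubdiff (inner ℝ (W t r) (x i)))
    (hflow : ∀ t, 0 ≤ t → ∀ r,
      W t r = W 0 r - ∫ τ in (0 : ℝ)..t, lossGradient x y a (W τ) (s τ) r) {T : ℝ} (hT : 0 ≤ T)
    (r : Fin m) (v : E) :
    AbsolutelyContinuousOnInterval (fun t => relu (inner ℝ (W t r) v)) 0 T := by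
  obtain ⟨L, hL⟩ := lipschitzOnWith_weights ha hW hsm hs hflow (T := T)
  refine LipschitzOnWith.absolutelyContinuousOnInterval (K := L * ‖v‖₊)
    (LipschitzOnWith.of_dist_le_mul fun t ht t' ht' => ?_)
  rw [Set.uIcc_of_le hT] at ht ht'
  have h := (hL r).dist_le_mul t ht t' ht'
  calc dist (relu (inner ℝ (W t r) v)) (relu (inner ℝ (W t' r) v))
      ≤ |(inner ℝ (W t r) v : ℝ) - inner ℝ (W t' r) v| := abs_max_sub_max_le_abs _ _ _
    _ ≤ ‖W t r - W t' r‖ * ‖v‖ := by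
        rw [← inner_sub_left]
        exact abs_real_inner_le_norm _ _
    _ ≤ L * dist t t' * ‖v‖ := by
        rw [← dist_eq_norm]
        gcongr
    _ = _ := by
        push_cast
        ring

theorem absolutelyContinuousOnInterval_sqError (ha : ∀ r, a r ^ 2 = 1)
    (hW : ContinuousOn W (Set.Ici 0)) (hsm : ∀ r i, Measurable fun t => s t r i)
    (hs : ∀ t, 0 ≤ t → ∀ r i, s t r i ∈ reluSubdiff (inner ℝ (W t r) (x i)))
    (hflow : ∀ t, 0 ≤ t → ∀ r,
      W t r = W 0 r - ∫ τ in (0 : ℝ)..t, lossGradient x y a (W τ) (s τ) r) {T : ℝ} (hT : 0 ≤ T) :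
    AbsolutelyContinuousOnInterval (fun t => sqError x y a (W t)) 0 T := by
  refine absolutelyContinuousOnInterval_sum _ fun i _ => ?_
  have h : AbsolutelyContinuousOnInterval (fun t => twoLayerNet (W t) a (x i) - y i) 0 T := by
    refine AbsolutelyContinuousOnInterval.sub ?_
      (LipschitzWith.const (y i)).lipschitzOnWith.absolutelyContinuousOnInterval
    refine AbsolutelyContinuousOnInterval.const_mul _
      (absolutelyContinuousOnInterval_sum _ fun r _ => ?_)
    exact (absolutelyContinuousOnInterval_relu ha hW hsm hs hflow hT r (x i)).const_mul _
  simpa only [sq] using h.fun_mul h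

/-- The energy identity. Off a null set all weights and all ReLU compositions are differentiable in
time, and there `hasDerivAt_relu_comp` gives the chain rule for whichever selection `s` drives the
flow. -/
theorem ae_hasDerivAt_sqError [CompleteSpace E] (ha : ∀ r, a r ^ 2 = 1)
    (hW : ContinuousOn W (Set.Ici 0)) (hsm : ∀ r i, Measurable fun t => s t r i)
    (hs : ∀ t, 0 ≤ t → ∀ r i, s t r i ∈ reluSubdiff (inner ℝ (W t r) (x i)))
    (hflow : ∀ t, 0 ≤ t → ∀ r,
      W t r = W 0 r - ∫ τ in (0 : ℝ)..t, lossGradient x y a (W τ) (s τ) r) {T : ℝ} (hT : 0 ≤ T) :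
    ∀ᵐ t, t ∈ Set.Ioo 0 T → HasDerivAt (fun τ => sqError x y a (W τ))
      (-2 * ∑ r, ‖lossGradient x y a (W t) (s t) r‖ ^ 2) t := by
  have hd : ∀ᵐ t, ∀ r i, t ∈ Set.uIcc 0 T →
      DifferentiableAt ℝ (fun τ => relu (inner ℝ (W τ r) (x i))) t :=
    ae_all_iff.2 fun r => ae_all_iff.2 fun i =>
      (absolutelyContinuousOnInterval_relu ha hW hsm hs hflow hT r (x i)).ae_differentiableAt
  filter_upwards [hd, ae_hasDerivAt_weights ha hW hsm hs hflow hT] with t ht hWt htT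
  rw [Set.uIcc_of_le hT] at ht
  set g := fun r => lossGradient x y a (W t) (s t) r with hg
  have hrelu : ∀ r i, HasDerivAt (fun τ => relu (inner ℝ (W τ r) (x i)))
      (s t r i * inner ℝ (-g r) (x i)) t := fun r i => by
    refine hasDerivAt_relu_comp ?_ (ht r i (Set.Ioo_subset_Icc_self htT)) (hs t htT.1.le r i)
    simpa using (hWt htT r).inner ℝ (hasDerivAt_const t (x i))
  have hnet : ∀ i, HasDerivAt (fun τ => twoLayerNet (W τ) a (x i))
      (1 / √(m : ℝ) * ∑ r, a r * (s t r i * inner ℝ (-g r) (x i))) t := fun i =>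
    (HasDerivAt.fun_sum fun r _ => (hrelu r i).const_mul (a r)).const_mul _
  have hsq : HasDerivAt (fun τ => sqError x y a (W τ))
      (∑ i, 2 * (twoLayerNet (W t) a (x i) - y i) *
        (1 / √(m : ℝ) * ∑ r, a r * (s t r i * inner ℝ (-g r) (x i)))) t := by
    refine HasDerivAt.fun_sum fun i _ => ?_
    simpa using ((hnet i).sub_const (y i)).fun_pow 2
  convert hsq using 1
  -- Only one factor of `⟨g r, g r⟩` is expanded, to match the double sum from the chain rule.
  have hgg : ∀ r, ‖g r‖ ^ 2 = ∑ i, (1 / √(m : ℝ)) * (twoLayerNet (W t) a (x i) - y i) * a r *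
      s t r i * inner ℝ (g r) (x i) := fun r => by
    rw [← real_inner_self_eq_norm_sq]
    change inner ℝ (lossGradient x y a (W t) (s t) r) (g r) = _
    rw [lossGradient, sum_inner]
    exact Finset.sum_congr rfl fun i _ => by rw [real_inner_smul_left, real_inner_comm]
  simp only [Finset.mul_sum]
  rw [Finset.sum_comm]
  refine Finset.sum_congr rfl fun r _ => ?_
  rw [hgg, Finset.mul_sum]
  refine Finset.sum_congr rfl fun i _ => ?_
  rw [inner_neg_left]
  ring

/-- Grönwall: `exp (lam t)` times the error is nonincreasing. Coercivity `lam / 2` suffices because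
the energy identity carries a factor `2`. -/
theorem sqError_le_exp [CompleteSpace E] (ha : ∀ r, a r ^ 2 = 1)
    (hW : ContinuousOn W (Set.Ici 0)) (hsm : ∀ r i, Measurable fun t => s t r i)
    (hs : ∀ t, 0 ≤ t → ∀ r i, s t r i ∈ reluSubdiff (inner ℝ (W t r) (x i)))
    (hflow : ∀ t, 0 ≤ t → ∀ r,
      W t r = W 0 r - ∫ τ in (0 : ℝ)..t, lossGradient x y a (W τ) (s τ) r) {T : ℝ} (hT : 0 ≤ T)
    {lam : ℝ} (hcoer : ∀ t ∈ Set.Ioo 0 T, lam / 2 * sqError x y a (W t) ≤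
      ∑ r, ‖lossGradient x y a (W t) (s t) r‖ ^ 2) :
    sqError x y a (W T) ≤ Real.exp (-(lam * T)) * sqError x y a (W 0) := by
  have hexp : ∀ t, HasDerivAt (fun t => Real.exp (lam * t)) (Real.exp (lam * t) * lam) t :=
    fun t => by simpa using ((hasDerivAt_id t).const_mul lam).exp
  have hac : AbsolutelyContinuousOnInterval
      (fun t => Real.exp (lam * t) * sqError x y a (W t)) 0 T := by
    refine AbsolutelyContinuousOnInterval.fun_mul ?_
      (absolutelyContinuousOnInterval_sqError ha hW hsm hs hflow hT)
    refine ContDiffOn.absolutelyContinuousOnInterval (ContDiff.contDiffOn ?_)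
    fun_prop
  have hle := le_of_ae_hasDerivAt_nonpos hT hac (by
    filter_upwards [ae_hasDerivAt_sqError ha hW hsm hs hflow hT] with t ht htT
    refine ⟨_, ?_, (hexp t).mul (ht htT)⟩
    have h1 := hcoer t htT
    have h2 := Real.exp_pos (lam * t)
    have h3 : 0 ≤ Real.exp (lam * t) * (∑ r, ‖lossGradient x y a (W t) (s t) r‖ ^ 2 -
      lam / 2 * sqError x y a (W t)) := mul_nonneg h2.le (by linarith)
    linarith)
  simp only [mul_zero, Real.exp_zero, one_mul] at hle
  rw [Real.exp_neg, inv_mul_eq_div, le_div_iff₀ (Real.exp_pos _), mul_comm]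
  exact hle

/-- The speed is bounded by the root of the error, which decays at rate `lam / 2`. Its time integral
is at most `2 / lam` times its initial bound, uniformly in `T`. -/
theorem norm_weights_sub_le [CompleteSpace E] (ha : ∀ r, a r ^ 2 = 1)
    (hs : ∀ t, 0 ≤ t → ∀ r i, s t r i ∈ reluSubdiff (inner ℝ (W t r) (x i)))
    (hflow : ∀ t, 0 ≤ t → ∀ r,
      W t r = W 0 r - ∫ τ in (0 : ℝ)..t, lossGradient x y a (W τ) (s τ) r) {T : ℝ} (hT : 0 ≤ T)
    {lam M : ℝ} (hlam : 0 < lam) (hM0 : 0 ≤ M) (hM : ∀ i, ‖x i‖ ≤ M)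
    (hdecay : ∀ t ∈ Set.Ioc 0 T,
      sqError x y a (W t) ≤ Real.exp (-(lam * t)) * sqError x y a (W 0)) (r : Fin m) :
    ‖W T r - W 0 r‖ ≤ 2 * M * √n * √(sqError x y a (W 0)) / (√m * lam) := by
  set D := M * √n / √m * √(sqError x y a (W 0)) with hD
  have hD0 : 0 ≤ D := by positivity
  have hint : ∫ t in (0 : ℝ)..T, D * Real.exp (-(lam / 2) * t) =
      D * (2 / lam * (1 - Real.exp (-(lam / 2) * T))) := by
    rw [intervalIntegral.integral_const_mul, 
      intervalIntegral.integral_comp_mul_left (fun u => Real.exp u) (by linarith), integral_exp]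
    simp only [mul_zero, Real.exp_zero, smul_eq_mul]
    field_simp
    ring
  rw [hflow T hT r, sub_sub_cancel_left, norm_neg]
  have hb : ‖∫ τ in (0 : ℝ)..T, lossGradient x y a (W τ) (s τ) r‖ ≤
      ∫ t in (0 : ℝ)..T, D * Real.exp (-(lam / 2) * t) := by
    refine intervalIntegral.norm_integral_le_of_norm_le hT ?_ (Continuous.intervalIntegrable
      (by fun_prop) _ _)
    filter_upwards with t ht
    refine (norm_lossGradient_le hM r (ha r) fun i => ?_).trans ?_
    · obtain ⟨h0, h1, -⟩ := hs t ht.1.le r i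
      exact abs_le.2 ⟨by linarith, h1⟩
    · have h : √(sqError x y a (W t)) ≤ Real.exp (-(lam / 2) * t) * √(sqError x y a (W 0)) := by
        refine Real.sqrt_le_iff.2 ⟨by positivity, (hdecay t ht).trans_eq ?_⟩
        rw [mul_pow, Real.sq_sqrt (sqError_nonneg _ _ _ _), ← Real.exp_nat_mul]
        congr 2
        push_cast
        ring
      calc M * √n / √m * √(sqError x y a (W t))
          ≤ M * √n / √m * (Real.exp (-(lam / 2) * t) * √(sqError x y a (W 0))) := by gcongr
        _ = _ := by rw [hD]; ring
  rw [hint] at hb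
  refine hb.trans ?_
  calc D * (2 / lam * (1 - Real.exp (-(lam / 2) * T))) ≤ D * (2 / lam * 1) := by
        gcongr
        linarith [Real.exp_pos (-(lam / 2) * T)]
    _ = _ := by
        rw [hD]
        ring

/-- Gradient flow converges at rate `lam` if it starts with a small error and the quadratic forms
of the kernel matrices are bounded below by `lam / 2` as long as no weight has moved by more than
`R`. -/
theorem sqError_le_exp_of_isGradientFlow [CompleteSpace E] (ha : ∀ r, a r ^ 2 = 1)
    (hW : IsGradientFlow x y a W) {lam M R : ℝ} (hlam : 0 < lam) (hM0 : 0 ≤ M)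
    (hM : ∀ i, ‖x i‖ ≤ M) (hm : 0 < m)
    (hcoer : ∀ (W' : Fin m → E) (s' : Fin m → Fin n → ℝ), (∀ r, ‖W' r - W 0 r‖ ≤ R) →
      (∀ r i, s' r i ∈ reluSubdiff (inner ℝ (W' r) (x i))) → ∀ v : Fin n → ℝ,
      lam / 2 * ∑ i, v i ^ 2 ≤ 1 / (m : ℝ) * ∑ r, ‖∑ i, (v i * s' r i) • x i‖ ^ 2)
    (hR : 2 * M * √n * √(sqError x y a (W 0)) < √m * lam * R) {t : ℝ} (ht : 0 ≤ t) :
    sqError x y a (W t) ≤ Real.exp (-(lam * t)) * sqError x y a (W 0) := by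
  obtain ⟨hWc, s, hsm, hs, hflow⟩ := hW
  -- Confinement is required only strictly before `T`, so this still applies at the first exit time.
  have key : ∀ T, 0 ≤ T → (∀ τ ∈ Set.Ioo 0 T, ∀ r, ‖W τ r - W 0 r‖ ≤ R) →
      sqError x y a (W T) ≤ Real.exp (-(lam * T)) * sqError x y a (W 0) := fun T hT hclose => by
    refine sqError_le_exp ha hWc hsm hs hflow hT fun τ hτ => ?_
    simp only [fun r => norm_sq_lossGradient (x := x) (y := y) (W := W τ) (s := s τ) r (ha r),
      ← Finset.mul_sum]
    exact hcoer _ _ (hclose τ hτ) (hs τ hτ.1.le) _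
  have hm' : 0 < √(m : ℝ) := Real.sqrt_pos.2 (Nat.cast_pos.2 hm)
  have hR0 : 0 < R := by
    have h1 : 0 ≤ 2 * M * √n * √(sqError x y a (W 0)) := by positivity
    have h2 : 0 < √(m : ℝ) * lam := by positivity
    exact pos_of_mul_pos_right (h1.trans_lt hR) h2.le
  suffices hclose : ∀ τ, 0 ≤ τ → ∀ r, ‖W τ r - W 0 r‖ < R from
    key t ht fun τ hτ r => (hclose τ hτ.1.le r).le
  by_contra! hcon
  -- The infimum of `S` is the first exit time and, `S` being closed, is attained. Decay holds up to
  -- it, so the drift there is strictly below `R` by `hR`, a contradiction.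
  set S : Set ℝ := {τ | τ ∈ Set.Ici 0 ∧ ∃ r, R ≤ ‖W τ r - W 0 r‖} with hS
  have hSne : S.Nonempty := by
    obtain ⟨τ, hτ, r, hr⟩ := hcon
    exact ⟨τ, hτ, r, hr⟩
  have hSc : IsClosed S := by
    have : S = ⋃ r, {τ | τ ∈ Set.Ici 0 ∧ R ≤ ‖W τ r - W 0 r‖} := by
      ext τ
      simp [hS]
    rw [this]
    refine isClosed_iUnion_of_finite fun r => ?_
    have hc : ContinuousOn (fun τ => ‖W τ r - W 0 r‖) (Set.Ici 0) :=
      (((continuous_apply r).comp_continuousOn hWc).sub continuousOn_const).norm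
    exact hc.preimage_isClosed_of_isClosed isClosed_Ici isClosed_Ici
  have hSb : BddBelow S := ⟨0, fun τ hτ => hτ.1⟩
  obtain ⟨hT0, r, hr⟩ := hSc.csInf_mem hSne hSb
  have hbefore : ∀ τ, 0 ≤ τ → τ < sInf S → ∀ r, ‖W τ r - W 0 r‖ ≤ R := fun τ hτ0 hτ r => by
    by_contra! h
    exact notMem_of_lt_csInf hτ hSb ⟨hτ0, r, h.le⟩
  have hmove := norm_weights_sub_le ha hs hflow hT0 hlam hM0 hM
    (fun τ hτ => key τ hτ.1.le fun τ' hτ' => hbefore τ' hτ'.1.le (hτ'.2.trans_le hτ.2)) r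
  have : 2 * M * √n * √(sqError x y a (W 0)) / (√m * lam) < R := by
    rw [div_lt_iff₀ (by positivity)]
    linarith
  linarith

end Flow


/-! ### Quadratic forms and eigenvalues -/

section Spectrum

variable {n : ℕ} {A : Matrix (Fin n) (Fin n) ℝ}

theorem posSemidef_sub_smul_one_iff (hA : A.IsHermitian) {c : ℝ} :
    (A - c • (1 : Matrix (Fin n) (Fin n) ℝ)).PosSemidef ↔ ∀ μ ∈ spectrum ℝ A, c ≤ μ := by
  have hH : (A - c • (1 : Matrix (Fin n) (Fin n) ℝ)).IsHermitian :=
    hA.sub (by simp [Matrix.IsHermitian])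
  have hmem : ∀ μ, μ ∈ spectrum ℝ A ↔
      μ - c ∈ spectrum ℝ (A - c • (1 : Matrix (Fin n) (Fin n) ℝ)) := fun μ => by
    rw [← sub_add_cancel μ c, spectrum.add_mem_iff, Algebra.algebraMap_eq_smul_one,
      sub_add_cancel, neg_add_eq_sub]
  rw [Matrix.posSemidef_iff_isHermitian_and_spectrum_nonneg]
  refine ⟨fun h μ hμ => ?_, fun h => ⟨hH, fun μ hμ => ?_⟩⟩
  · exact sub_nonneg.1 (h.2 ((hmem μ).1 hμ))
  · have := h (μ + c) ((hmem _).2 (by simpa using hμ))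
    simpa using this

theorem dotProduct_sub_smul_one_mulVec (c : ℝ) (v : Fin n → ℝ) :
    v ⬝ᵥ (A - c • (1 : Matrix (Fin n) (Fin n) ℝ)) *ᵥ v = v ⬝ᵥ A *ᵥ v - c * ∑ i, v i ^ 2 := by
  rw [Matrix.sub_mulVec, dotProduct_sub, Matrix.smul_mulVec, Matrix.one_mulVec, dotProduct_smul,
    smul_eq_mul]
  simp only [dotProduct, sq]

theorem lambdaMin_mul_le (hA : A.IsHermitian) (v : Fin n → ℝ) :
    lambdaMin A * ∑ i, v i ^ 2 ≤ v ⬝ᵥ A *ᵥ v := by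
  have h := (posSemidef_sub_smul_one_iff hA (c := lambdaMin A)).2 fun μ hμ =>
    csInf_le A.finite_real_spectrum.bddBelow hμ
  have h1 := h.dotProduct_mulVec_nonneg v
  rw [star_trivial, dotProduct_sub_smul_one_mulVec] at h1
  linarith

theorem le_lambdaMin (hn : 0 < n) (hA : A.IsHermitian) {c : ℝ}
    (h : ∀ v : Fin n → ℝ, c * ∑ i, v i ^ 2 ≤ v ⬝ᵥ A *ᵥ v) : c ≤ lambdaMin A := by
  have hps : (A - c • (1 : Matrix (Fin n) (Fin n) ℝ)).PosSemidef := by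
    refine Matrix.PosSemidef.of_dotProduct_mulVec_nonneg
      (hA.sub (by simp [Matrix.IsHermitian])) fun v => ?_
    rw [star_trivial, dotProduct_sub_smul_one_mulVec]
    linarith [h v]
  -- Without an index the spectrum is empty and its infimum is the default value `0`.
  have : Nonempty (Fin n) := ⟨⟨0, hn⟩⟩
  refine le_csInf ?_ ((posSemidef_sub_smul_one_iff hA).1 hps)
  rw [hA.spectrum_real_eq_range_eigenvalues]
  exact Set.range_nonempty _

/-- The forms differ by at most `ε (∑ |v i|)²`, and Cauchy–Schwarz costs a factor `n`. This is why
entrywise tolerances below have order `lam / n`. -/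
theorem dotProduct_mulVec_ge_of_entry_close {A B : Matrix (Fin n) (Fin n) ℝ} {ε : ℝ}
    (h : ∀ i j, |A i j - B i j| ≤ ε) (v : Fin n → ℝ) :
    v ⬝ᵥ B *ᵥ v - ε * n * ∑ i, v i ^ 2 ≤ v ⬝ᵥ A *ᵥ v := by
  rcases Nat.eq_zero_or_pos n with rfl | hn
  · simp
  have hε : 0 ≤ ε := (abs_nonneg _).trans (h ⟨0, hn⟩ ⟨0, hn⟩)
  have h1 : v ⬝ᵥ B *ᵥ v - v ⬝ᵥ A *ᵥ v = ∑ i, ∑ j, v i * v j * (B i j - A i j) := by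
    rw [← dotProduct_sub, ← Matrix.sub_mulVec]
    simp only [dotProduct, Matrix.mulVec, Finset.mul_sum, Matrix.sub_apply]
    exact Finset.sum_congr rfl fun i _ => Finset.sum_congr rfl fun j _ => by ring
  have h2 : ∑ i, ∑ j, v i * v j * (B i j - A i j) ≤ ∑ i, ∑ j, |v i| * |v j| * ε := by
    refine Finset.sum_le_sum fun i _ => Finset.sum_le_sum fun j _ => ?_
    refine (le_abs_self _).trans ?_
    rw [abs_mul, abs_mul, abs_sub_comm]
    exact mul_le_mul_of_nonneg_left (h i j) (by positivity)
  have h3 : ∑ i, ∑ j, |v i| * |v j| * ε = ε * (∑ i, |v i|) ^ 2 := by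
    rw [sq, Finset.sum_mul_sum, Finset.mul_sum]
    exact Finset.sum_congr rfl fun i _ => by
      rw [Finset.mul_sum]
      exact Finset.sum_congr rfl fun j _ => by ring
  have h4 : (∑ i, |v i|) ^ 2 ≤ n * ∑ i, v i ^ 2 := by
    simpa [sq_abs] using
      sq_sum_le_card_mul_sum_sq (s := (Finset.univ : Finset (Fin n))) (f := fun i => |v i|)
  have h5 := mul_le_mul_of_nonneg_left h4 hε
  linarith

theorem toReal_inv_condNumber_sq_le {ι : Type*} [Fintype ι] {X : Matrix ι (Fin n) ℝ} {lam : ℝ}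
    (hmax : 1 ≤ sigmaMax X) (hlam : 0 ≤ lam) (h : lambdaMin (Xᵀ * X) ≤ lam) :
    ((condNumber X ^ 2)⁻¹).toReal ≤ lam := by
  have h0 : 0 ≤ sigmaMin X := Real.sqrt_nonneg _
  -- When `σ_min = 0` the condition number is `∞`, and both sides are `0`.
  have h1 : ((condNumber X ^ 2)⁻¹).toReal = (sigmaMin X / sigmaMax X) ^ 2 := by
    rw [condNumber, ENNReal.toReal_inv, ENNReal.toReal_pow, ENNReal.toReal_div,
      ENNReal.toReal_ofReal h0, ENNReal.toReal_ofReal (by linarith), ← inv_pow, inv_div]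
  have h2 : sigmaMin X ^ 2 ≤ lam := by
    rw [sigmaMin]
    rcases le_total 0 (lambdaMin (Xᵀ * X)) with h' | h'
    · rwa [Real.sq_sqrt h']
    · rw [Real.sqrt_eq_zero_of_nonpos h']
      simpa using hlam
  rw [h1]
  refine le_trans ?_ h2
  have : sigmaMin X / sigmaMax X ≤ sigmaMin X := div_le_self h0 hmax
  have h3 : 0 ≤ sigmaMin X / sigmaMax X := div_nonneg h0 (by linarith)
  gcongr

end Spectrum

/-! ### Kernel matrices -/

section Kernel

variable {E : Type*} [NormedAddCommGroup E] [InnerProductSpace ℝ E] {m n : ℕ}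

/-- The kernel matrix of the network with ReLU derivatives `s`. -/
noncomputable def kernelMatrix (x : Fin n → E) (s : Fin m → Fin n → ℝ) :
    Matrix (Fin n) (Fin n) ℝ :=
  Matrix.of fun i j => 1 / (m : ℝ) * ∑ r, s r i * s r j * inner ℝ (x i) (x j)

/-- The indicator of `0 ≤ ⟨w, v⟩`. -/
noncomputable def activation (w v : E) : ℝ := if 0 ≤ (inner ℝ w v : ℝ) then 1 else 0

/-- The indicator of `|⟨w, v⟩| ≤ R ‖v‖`: whether moving `w` by at most `R` can change the
sign of `⟨w, v⟩`. -/
noncomputable def nearKink (R : ℝ) (w v : E) : ℝ :=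
  if |(inner ℝ w v : ℝ)| ≤ R * ‖v‖ then 1 else 0

theorem activation_mem_Icc (w v : E) : activation w v ∈ Set.Icc (0 : ℝ) 1 := by
  unfold activation
  split_ifs <;> simp

theorem nearKink_nonneg (R : ℝ) (w v : E) : 0 ≤ nearKink R w v := by
  unfold nearKink
  split_ifs <;> simp

theorem norm_sq_sum_smul (x : Fin n → E) (u : Fin n → ℝ) :
    ‖∑ i, u i • x i‖ ^ 2 = ∑ i, ∑ j, u i * u j * inner ℝ (x i) (x j) := by
  rw [← real_inner_self_eq_norm_sq, sum_inner]
  refine Finset.sum_congr rfl fun i _ => ?_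
  rw [inner_sum]
  refine Finset.sum_congr rfl fun j _ => ?_
  rw [real_inner_smul_left, real_inner_smul_right]
  ring

theorem dotProduct_kernelMatrix_mulVec (x : Fin n → E) (s : Fin m → Fin n → ℝ) (v : Fin n → ℝ) :
    v ⬝ᵥ kernelMatrix x s *ᵥ v = 1 / (m : ℝ) * ∑ r, ‖∑ i, (v i * s r i) • x i‖ ^ 2 := by
  simp only [norm_sq_sum_smul]
  rw [Finset.sum_comm, Finset.mul_sum]
  refine Finset.sum_congr rfl fun i _ => ?_
  rw [Finset.sum_comm]
  simp only [Matrix.mulVec, dotProduct, Finset.mul_sum]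
  refine Finset.sum_congr rfl fun j _ => ?_
  simp only [kernelMatrix, Matrix.of_apply, Finset.mul_sum, Finset.sum_mul]
  exact Finset.sum_congr rfl fun r _ => by ring

/-- By Cauchy–Schwarz the move changes `⟨w, v⟩` by at most `R ‖v‖`, too little to reach zero. Hence
the subdifferential at the new point is a singleton. -/
theorem eq_activation_of_nearKink_eq_zero {R s : ℝ} {w w' v : E} (hw : ‖w' - w‖ ≤ R)
    (hs : s ∈ reluSubdiff (inner ℝ w' v)) (h : nearKink R w v = 0) : s = activation w v := by
  obtain ⟨-, -, h1, h0⟩ := hs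
  have hfar : R * ‖v‖ < |(inner ℝ w v : ℝ)| := by
    by_contra! hc
    simp [nearKink, hc] at h
  have hd : |(inner ℝ w' v : ℝ) - inner ℝ w v| ≤ R * ‖v‖ := by
    rw [← inner_sub_left]
    exact (abs_real_inner_le_norm _ _).trans (by gcongr)
  rw [abs_le] at hd
  rcases le_or_gt 0 (inner ℝ w v : ℝ) with hp | hp
  · rw [abs_of_nonneg hp] at hfar
    rw [h1 (by linarith), activation, if_pos hp]
  · rw [abs_of_neg hp] at hfar
    rw [h0 (by linarith), activation, if_neg (not_le.2 hp)]

/-- Both products lie in `[0, 1]`, and they coincide unless one of the two inner products starts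
near its kink. -/
theorem abs_mul_sub_mul_activation_le {R s₁ s₂ : ℝ} {w w' v₁ v₂ : E} (hw : ‖w' - w‖ ≤ R)
    (h₁ : s₁ ∈ reluSubdiff (inner ℝ w' v₁)) (h₂ : s₂ ∈ reluSubdiff (inner ℝ w' v₂)) :
    |s₁ * s₂ - activation w v₁ * activation w v₂| ≤ nearKink R w v₁ + nearKink R w v₂ := by
  have hb : |s₁ * s₂ - activation w v₁ * activation w v₂| ≤ 1 := by
    obtain ⟨a0, a1⟩ := activation_mem_Icc w v₁
    obtain ⟨b0, b1⟩ := activation_mem_Icc w v₂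
    obtain ⟨c0, c1, -⟩ := h₁
    obtain ⟨d0, d1, -⟩ := h₂
    have e1 := mul_le_one₀ a1 b0 b1
    have e2 := mul_le_one₀ c1 d0 d1
    have e3 := mul_nonneg a0 b0
    have e4 := mul_nonneg c0 d0
    exact abs_le.2 ⟨by linarith, by linarith⟩
  have hdich : ∀ v : E, nearKink R w v = 0 ∨ nearKink R w v = 1 := fun v => by
    unfold nearKink
    split_ifs <;> simp
  rcases hdich v₁ with k₁ | k₁
  · rcases hdich v₂ with k₂ | k₂
    · rw [eq_activation_of_nearKink_eq_zero hw h₁ k₁, eq_activation_of_nearKink_eq_zero hw h₂ k₂,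
        k₁, k₂]
      simp
    · rw [k₁, k₂]
      linarith
  · linarith [nearKink_nonneg R w v₂]

/-- The change is charged to near-kink neurons of the initial `W` alone. One event at initialisation
thus covers every `W'` in the ball and every selection. -/
theorem abs_kernelMatrix_sub_le {x : Fin n → E} {M R β : ℝ} (hM : ∀ i, ‖x i‖ ≤ M)
    {W W' : Fin m → E} {s : Fin m → Fin n → ℝ} (hW : ∀ r, ‖W' r - W r‖ ≤ R)
    (hs : ∀ r i, s r i ∈ reluSubdiff (inner ℝ (W' r) (x i)))
    (hβ : ∀ i, 1 / (m : ℝ) * ∑ r, nearKink R (W r) (x i) ≤ β) (i j : Fin n) :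
    |kernelMatrix x s i j - kernelMatrix x (fun r i => activation (W r) (x i)) i j| ≤
      2 * M ^ 2 * β := by
  have hM0 : 0 ≤ M := (norm_nonneg _).trans (hM i)
  have hin : |(inner ℝ (x i) (x j) : ℝ)| ≤ M ^ 2 := by
    rw [sq]
    exact (abs_real_inner_le_norm _ _).trans (mul_le_mul (hM i) (hM j) (norm_nonneg _) hM0)
  simp only [kernelMatrix, Matrix.of_apply]
  rw [← mul_sub, ← Finset.sum_sub_distrib, abs_mul, abs_of_nonneg (by positivity)]
  have h1 : |∑ r, (s r i * s r j * inner ℝ (x i) (x j) -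
      activation (W r) (x i) * activation (W r) (x j) * inner ℝ (x i) (x j))| ≤
      ∑ r, (nearKink R (W r) (x i) + nearKink R (W r) (x j)) * M ^ 2 := by
    refine (Finset.abs_sum_le_sum_abs _ _).trans (Finset.sum_le_sum fun r _ => ?_)
    rw [← sub_mul, abs_mul]
    exact mul_le_mul (abs_mul_sub_mul_activation_le (hW r) (hs r i) (hs r j)) hin (abs_nonneg _)
      (add_nonneg (nearKink_nonneg _ _ _) (nearKink_nonneg _ _ _))
  calc _ ≤ 1 / (m : ℝ) * ∑ r, (nearKink R (W r) (x i) + nearKink R (W r) (x j)) * M ^ 2 := by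
        gcongr
    _ = M ^ 2 * (1 / (m : ℝ) * ∑ r, nearKink R (W r) (x i) +
          1 / (m : ℝ) * ∑ r, nearKink R (W r) (x j)) := by
        rw [← Finset.sum_mul, Finset.sum_add_distrib]
        ring
    _ ≤ M ^ 2 * (β + β) := by
        gcongr
        exacts [hβ i, hβ j]
    _ = _ := by ring

theorem abs_activation_mul_le {x : Fin n → E} {M : ℝ} (hM : ∀ i, ‖x i‖ ≤ M) (w : E)
    (i j : Fin n) :
    |activation w (x i) * activation w (x j) * inner ℝ (x i) (x j)| ≤ M ^ 2 := by
  obtain ⟨a0, a1⟩ := activation_mem_Icc w (x i)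
  obtain ⟨b0, b1⟩ := activation_mem_Icc w (x j)
  have hin : |(inner ℝ (x i) (x j) : ℝ)| ≤ M ^ 2 := by
    rw [sq]
    exact (abs_real_inner_le_norm _ _).trans
      (mul_le_mul (hM i) (hM j) (norm_nonneg _) ((norm_nonneg _).trans (hM i)))
  rw [abs_mul, abs_of_nonneg (mul_nonneg a0 b0)]
  exact (mul_le_of_le_one_left (abs_nonneg _) (mul_le_one₀ a1 b0 b1)).trans hin

/-- Error budget per entry: `lam / (4 n)` from sampling and `2 M² · lam / (8 M² n) = lam / (4 n)`
from motion. Together they cost `lam / 2` in the quadratic form. -/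
theorem kernelMatrix_coercive {x : Fin n → E} {H : Matrix (Fin n) (Fin n) ℝ}
    (hH : H.IsHermitian) {M R lam : ℝ} (hlamH : lam ≤ lambdaMin H) (hn : 0 < n) (hM0 : 0 < M)
    (hM : ∀ i, ‖x i‖ ≤ M) {W : Fin m → E}
    (hconc : ∀ i j,
      |kernelMatrix x (fun r i => activation (W r) (x i)) i j - H i j| ≤ lam / (4 * n))
    (hkink : ∀ i, 1 / (m : ℝ) * ∑ r, nearKink R (W r) (x i) ≤ lam / (8 * M ^ 2 * n))
    {W' : Fin m → E} {s : Fin m → Fin n → ℝ} (hW : ∀ r, ‖W' r - W r‖ ≤ R)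
    (hs : ∀ r i, s r i ∈ reluSubdiff (inner ℝ (W' r) (x i))) (v : Fin n → ℝ) :
    lam / 2 * ∑ i, v i ^ 2 ≤ 1 / (m : ℝ) * ∑ r, ‖∑ i, (v i * s r i) • x i‖ ^ 2 := by
  have hn' : (0 : ℝ) < n := Nat.cast_pos.2 hn
  rw [← dotProduct_kernelMatrix_mulVec]
  have hclose : ∀ i j, |kernelMatrix x s i j - H i j| ≤ lam / (2 * n) := fun i j => by
    have h1 := abs_kernelMatrix_sub_le hM hW hs hkink i j
    have h2 := hconc i j
    have h3 : 2 * M ^ 2 * (lam / (8 * M ^ 2 * n)) + lam / (4 * n) = lam / (2 * n) := by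
      field_simp
      ring
    linarith [abs_sub_le (kernelMatrix x s i j)
      (kernelMatrix x (fun r i => activation (W r) (x i)) i j) (H i j)]
  have h1 := dotProduct_mulVec_ge_of_entry_close hclose v
  have h2 := lambdaMin_mul_le hH v
  have h3 : lam / (2 * n) * n = lam / 2 := by field_simp
  rw [h3] at h1
  have h4 : lam * ∑ i, v i ^ 2 ≤ lambdaMin H * ∑ i, v i ^ 2 := by gcongr
  linarith

end Kernel


/-! ### The standard Gaussian measure -/

section Gaussian

variable {E : Type*} [NormedAddCommGroup E] [InnerProductSpace ℝ E] [FiniteDimensional ℝ E]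
  [MeasurableSpace E]

theorem gramInfinity_apply {n : ℕ} (x : Fin n → E) (i j : Fin n) :
    gramInfinity x i j =
      ∫ w, activation w (x i) * activation w (x j) * inner ℝ (x i) (x j) ∂stdGaussian E := by
  rw [gramInfinity, Matrix.of_apply]
  refine integral_congr_ae (Filter.Eventually.of_forall fun w => ?_)
  simp only [activation]
  split_ifs <;> simp_all

theorem isHermitian_gramInfinity {n : ℕ} (x : Fin n → E) : (gramInfinity x).IsHermitian := by
  ext i j
  simp only [Matrix.conjTranspose_apply, star_trivial, gramInfinity_apply]
  refine integral_congr_ae (Filter.Eventually.of_forall fun w => ?_)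
  simp only [real_inner_comm]
  ring

variable [BorelSpace E]

theorem measurable_activation (v : E) : Measurable fun w => activation w v :=
  Measurable.ite (measurableSet_le measurable_const (by fun_prop)) measurable_const
    measurable_const

theorem measurable_nearKink (R : ℝ) (v : E) : Measurable fun w => nearKink R w v :=
  Measurable.ite (measurableSet_le (by fun_prop) measurable_const) measurable_const
    measurable_const

theorem variance_inner_stdGaussian (v : E) :
    Var[fun w => (inner ℝ w v : ℝ); stdGaussian E] = ‖v‖ ^ 2 := by
  have h := variance_dual_stdGaussian (E := E) (innerSL ℝ v)
  rw [innerSL_apply_norm] at h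
  rw [← h]
  congr 1
  ext w
  exact real_inner_comm _ _

theorem integral_inner_stdGaussian (v : E) : ∫ w, (inner ℝ w v : ℝ) ∂stdGaussian E = 0 := by
  rw [← integral_strongDual_stdGaussian (E := E) (innerSL ℝ v)]
  exact integral_congr_ae (Filter.Eventually.of_forall fun w => real_inner_comm _ _)

theorem map_inner_stdGaussian (v : E) :
    (stdGaussian E).map (fun w => (inner ℝ w v : ℝ)) = gaussianReal 0 (‖v‖ ^ 2).toNNReal := by
  have h := IsGaussian.map_eq_gaussianReal (μ := stdGaussian E) (innerSL ℝ v)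
  rw [integral_strongDual_stdGaussian, variance_dual_stdGaussian, innerSL_apply_norm] at h
  rw [← h]
  congr 1
  ext w
  exact real_inner_comm _ _

/-- The projection has law `N(0, ‖v‖²)`, whose density is at most `1 / (2 ‖v‖)` since `√(2π) ≥ 2`.
The interval has length `2 R ‖v‖`. -/
theorem stdGaussian_abs_inner_le {v : E} (hv : v ≠ 0) (R : ℝ) :
    stdGaussian E {w | |(inner ℝ w v : ℝ)| ≤ R * ‖v‖} ≤ ENNReal.ofReal R := by
  have hv0 : 0 < ‖v‖ := norm_pos_iff.2 hv
  have hset : {w : E | |(inner ℝ w v : ℝ)| ≤ R * ‖v‖} =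
      (fun w => (inner ℝ w v : ℝ)) ⁻¹' Set.Icc (-(R * ‖v‖)) (R * ‖v‖) := by
    ext w
    simp only [Set.mem_ofPred_eq, Set.mem_preimage, Set.mem_Icc, abs_le]
  rw [hset, ← Measure.map_apply (by fun_prop) measurableSet_Icc, map_inner_stdGaussian,
    gaussianReal_apply _ (by simpa using hv)]
  have hpdf : ∀ t, gaussianPDF 0 (‖v‖ ^ 2).toNNReal t ≤ ENNReal.ofReal (1 / (2 * ‖v‖)) := by
    intro t
    rw [gaussianPDF]
    refine ENNReal.ofReal_le_ofReal ?_
    rw [gaussianPDFReal_def, Real.coe_toNNReal _ (by positivity)]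
    have h1 : 2 * ‖v‖ ≤ √(2 * Real.pi * ‖v‖ ^ 2) := by
      refine Real.le_sqrt_of_sq_le ?_
      have := Real.pi_gt_three
      nlinarith [sq_nonneg ‖v‖]
    calc (√(2 * Real.pi * ‖v‖ ^ 2))⁻¹ * Real.exp (-(t - 0) ^ 2 / (2 * ‖v‖ ^ 2))
        ≤ (2 * ‖v‖)⁻¹ * 1 := by
          gcongr
          refine Real.exp_le_one_iff.2 (div_nonpos_of_nonpos_of_nonneg ?_ (by positivity))
          linarith [sq_nonneg (t - 0)]
      _ = 1 / (2 * ‖v‖) := by ring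
  calc ∫⁻ t in Set.Icc (-(R * ‖v‖)) (R * ‖v‖), gaussianPDF 0 (‖v‖ ^ 2).toNNReal t
      ≤ ∫⁻ t in Set.Icc (-(R * ‖v‖)) (R * ‖v‖), ENNReal.ofReal (1 / (2 * ‖v‖)) :=
        lintegral_mono fun t => hpdf t
    _ = ENNReal.ofReal R := by
        rw [setLIntegral_const, Real.volume_Icc, ← ENNReal.ofReal_mul (by positivity)]
        congr 1
        field_simp
        ring

theorem lintegral_nearKink_le {v : E} (hv : v ≠ 0) (R : ℝ) :
    ∫⁻ w, ENNReal.ofReal (nearKink R w v) ∂stdGaussian E ≤ ENNReal.ofReal R := by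
  refine le_trans (le_of_eq ?_) (stdGaussian_abs_inner_le hv R)
  have hm : MeasurableSet {w : E | |(inner ℝ w v : ℝ)| ≤ R * ‖v‖} :=
    measurableSet_le (by fun_prop) measurable_const
  rw [← lintegral_indicator_one hm]
  refine lintegral_congr fun w => ?_
  by_cases h : |(inner ℝ w v : ℝ)| ≤ R * ‖v‖ <;> simp [nearKink, Set.indicator, h]

theorem lintegral_relu_sq_le (v : E) :
    ∫⁻ w, ENNReal.ofReal (relu (inner ℝ w v) ^ 2) ∂stdGaussian E ≤ ENNReal.ofReal (‖v‖ ^ 2) := by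
  have hm : MemLp (fun w => (inner ℝ w v : ℝ)) 2 (stdGaussian E) := by
    have h := IsGaussian.memLp_dual (stdGaussian E) (innerSL ℝ v) 2 (by simp)
    exact h.ae_eq (Filter.Eventually.of_forall fun w => real_inner_comm _ _)
  have h := hm.ofReal_variance_eq
  rw [variance_inner_stdGaussian, evariance_eq_lintegral_ofReal, integral_inner_stdGaussian] at h
  rw [h]
  refine lintegral_mono fun w => ENNReal.ofReal_le_ofReal ?_
  rw [sub_zero, relu]
  rcases le_total 0 (inner ℝ w v : ℝ) with h0 | h0
  · rw [max_eq_left h0]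
  · rw [max_eq_right h0]
    simpa using sq_nonneg (inner ℝ w v : ℝ)

theorem integrable_activation (v : E) : Integrable (fun w => activation w v) (stdGaussian E) :=
  Integrable.of_mem_Icc 0 1 (measurable_activation v).aemeasurable
    (Filter.Eventually.of_forall fun w => activation_mem_Icc w v)

/-- The law is symmetric, and at least one of `w`, `-w` activates `v`. -/
theorem half_le_integral_activation (v : E) : 1 / 2 ≤ ∫ w, activation w v ∂stdGaussian E := by
  have hmp : (stdGaussian E).map (LinearIsometryEquiv.neg ℝ (E := E)) = stdGaussian E :=
    stdGaussian_map _
  have h1 : ∫ w, activation (-w) v ∂stdGaussian E = ∫ w, activation w v ∂stdGaussian E := by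
    conv_rhs => rw [← hmp]
    rw [integral_map (by fun_prop) (measurable_activation v).aestronglyMeasurable]
    rfl
  have hint : Integrable (fun w => activation (-w) v) (stdGaussian E) :=
    Integrable.of_mem_Icc 0 1 ((measurable_activation v).comp measurable_neg).aemeasurable
      (Filter.Eventually.of_forall fun w => activation_mem_Icc (-w) v)
  have h2 : (1 : ℝ) ≤ ∫ w, (activation w v + activation (-w) v) ∂stdGaussian E := by
    have h3 : ∫ _w : E, (1 : ℝ) ∂stdGaussian E = 1 := by simp
    rw [← h3]
    refine integral_mono (integrable_const _) ((integrable_activation v).add hint) fun w => ?_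
    simp only [activation, inner_neg_left]
    split_ifs with h h' <;> norm_num
    linarith
  rw [integral_add (integrable_activation v) hint, h1] at h2
  linarith

/-! ### The Gram matrix -/

variable {n : ℕ}

theorem measurable_activation_mul (x : Fin n → E) (i j : Fin n) :
    Measurable fun w => activation w (x i) * activation w (x j) * inner ℝ (x i) (x j) :=
  ((measurable_activation _).mul (measurable_activation _)).mul_const _

theorem integrable_activation_mul (x : Fin n → E) (i j : Fin n) :
    Integrable (fun w => activation w (x i) * activation w (x j) * inner ℝ (x i) (x j))
      (stdGaussian E) := by
  refine Integrable.of_bound (measurable_activation_mul x i j).aestronglyMeasurable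
    ((∑ k, ‖x k‖) ^ 2) (Filter.Eventually.of_forall fun w => ?_)
  exact abs_activation_mul_le (fun k => Finset.single_le_sum (f := fun j => ‖x j‖)
    (fun _ _ => norm_nonneg _) (Finset.mem_univ k)) w i j

theorem dotProduct_gramInfinity_mulVec (x : Fin n → E) (v : Fin n → ℝ) :
    v ⬝ᵥ gramInfinity x *ᵥ v =
      ∫ w, ‖∑ i, (v i * activation w (x i)) • x i‖ ^ 2 ∂stdGaussian E := by
  have hexp : ∀ w, ‖∑ i, (v i * activation w (x i)) • x i‖ ^ 2 = ∑ i, ∑ j, v i * v j *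
      (activation w (x i) * activation w (x j) * inner ℝ (x i) (x j)) := fun w => by
    rw [norm_sq_sum_smul]
    exact Finset.sum_congr rfl fun i _ => Finset.sum_congr rfl fun j _ => by ring
  have hint : ∀ i j, Integrable (fun w => v i * v j *
      (activation w (x i) * activation w (x j) * inner ℝ (x i) (x j))) (stdGaussian E) :=
    fun i j => (integrable_activation_mul x i j).const_mul _
  simp only [hexp]
  rw [integral_finsetSum _ fun i _ => integrable_finsetSum _ fun j _ => hint i j]
  simp only [dotProduct, Matrix.mulVec, Finset.mul_sum]
  refine Finset.sum_congr rfl fun i _ => ?_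
  rw [integral_finsetSum _ fun j _ => hint i j]
  refine Finset.sum_congr rfl fun j _ => ?_
  rw [integral_const_mul, gramInfinity_apply]
  ring

/-- The smallest eigenvalue of the Gram matrix of the samples, scaled by `1 / 2`, is at most that of
`gramInfinity`, as the latter is the Hadamard product of the former with a positive semidefinite
matrix with diagonal `≥ 1`. -/
theorem mul_le_dotProduct_gramInfinity {x : Fin n → E} {μ : ℝ} (hμ : 0 ≤ μ)
    (h : ∀ u : Fin n → ℝ, μ * ∑ i, u i ^ 2 ≤ 1 / 2 * ‖∑ i, u i • x i‖ ^ 2) (v : Fin n → ℝ) :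
    μ * ∑ i, v i ^ 2 ≤ v ⬝ᵥ gramInfinity x *ᵥ v := by
  rw [dotProduct_gramInfinity_mulVec]
  have hsq : ∀ w v : E, activation w v ^ 2 = activation w v := fun w v => by
    unfold activation
    split_ifs <;> simp
  have hint : ∀ i, Integrable (fun w => v i ^ 2 * activation w (x i)) (stdGaussian E) :=
    fun i => (integrable_activation _).const_mul _
  have hle : ∫ w, 2 * μ * ∑ i, v i ^ 2 * activation w (x i) ∂stdGaussian E ≤
      ∫ w, ‖∑ i, (v i * activation w (x i)) • x i‖ ^ 2 ∂stdGaussian E := by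
    refine integral_mono ((integrable_finsetSum _ fun i _ => hint i).const_mul _) ?_ fun w => ?_
    · simp only [norm_sq_sum_smul]
      refine integrable_finsetSum _ fun i _ => integrable_finsetSum _ fun j _ => ?_
      refine ((integrable_activation_mul x i j).const_mul (v i * v j)).congr
        (Filter.Eventually.of_forall fun w => ?_)
      ring
    -- For each fixed `w`, coercivity is applied to `v` masked by the active samples; taking the
    -- mean over `w` then restores at least half of every `v i ^ 2`.
    · have := h fun i => v i * activation w (x i)
      simp only [mul_pow, hsq] at this
      simp only
      linarith
  refine le_trans ?_ hle
  rw [integral_const_mul, integral_finsetSum _ fun i _ => hint i, mul_assoc, mul_left_comm]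
  refine mul_le_mul_of_nonneg_left ?_ hμ
  rw [Finset.mul_sum]
  refine Finset.sum_le_sum fun i _ => ?_
  rw [integral_const_mul]
  have := half_le_integral_activation (x i)
  nlinarith [sq_nonneg (v i)]

/-- Test the form on a basis vector. The first bound trades powers of the eigenvalue for powers of
`M`; the second excludes zero samples. -/
theorem lambdaMin_gramInfinity_le {x : Fin n → E} {M : ℝ} (hM : ∀ i, ‖x i‖ ≤ M) (i : Fin n) :
    lambdaMin (gramInfinity x) ≤ M ^ 2 ∧ lambdaMin (gramInfinity x) ≤ ‖x i‖ ^ 2 := by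
  have h := lambdaMin_mul_le (isHermitian_gramInfinity x) (Pi.single i 1)
  have h1 : ∑ j, (Pi.single i 1 : Fin n → ℝ) j ^ 2 = 1 := by
    rw [Finset.sum_eq_single i] <;> simp +contextual
  rw [h1, mul_one, dotProduct_gramInfinity_mulVec] at h
  have h2 : ∀ w, ‖∑ j, ((Pi.single i 1 : Fin n → ℝ) j * activation w (x j)) • x j‖ ^ 2 ≤
      ‖x i‖ ^ 2 := fun w => by
    rw [Finset.sum_eq_single i (fun j _ hj => by simp [hj]) (by simp), norm_smul]
    obtain ⟨a0, a1⟩ := activation_mem_Icc w (x i)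
    have : ‖(Pi.single i 1 : Fin n → ℝ) i * activation w (x i)‖ ≤ 1 := by
      simpa [abs_of_nonneg a0] using a1
    have := mul_le_of_le_one_left (norm_nonneg (x i)) this
    gcongr
  have h3 : ∫ w, ‖∑ j, ((Pi.single i 1 : Fin n → ℝ) j * activation w (x j)) • x j‖ ^ 2
      ∂stdGaussian E ≤ ‖x i‖ ^ 2 := by
    have := integral_mono_of_nonneg (μ := stdGaussian E)
      (Filter.Eventually.of_forall fun w => sq_nonneg _) (integrable_const (‖x i‖ ^ 2))
      (Filter.Eventually.of_forall h2)
    simpa using this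
  refine ⟨(h.trans h3).trans ?_, h.trans h3⟩
  gcongr
  exact hM i

end Gaussian

theorem lambdaMin_scaledFeatureMatrix_le {w h n : ℕ} (hn : 0 < n)
    (x : Fin n → FeatureSpace w h) :
    lambdaMin ((scaledFeatureMatrix x)ᵀ * scaledFeatureMatrix x) ≤
      lambdaMin (gramInfinity x) := by
  set X := scaledFeatureMatrix x with hX
  have hXH : (Xᵀ * X).IsHermitian := by
    simpa using Matrix.isHermitian_conjTranspose_mul_self X
  have hform : ∀ u : Fin n → ℝ, u ⬝ᵥ (Xᵀ * X) *ᵥ u = 1 / 2 * ‖∑ i, u i • x i‖ ^ 2 := fun u => by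
    have hentry : ∀ i j, (Xᵀ * X) i j = 1 / 2 * inner ℝ (x i) (x j) := fun i j => by
      rw [Matrix.mul_apply, PiLp.inner_apply, Finset.mul_sum]
      refine Finset.sum_congr rfl fun q _ => ?_
      have h2 : (1 / √2 : ℝ) * (1 / √2) = 1 / 2 := by
        rw [div_mul_div_comm, Real.mul_self_sqrt zero_le_two, one_mul]
      simp only [hX, scaledFeatureMatrix, Matrix.transpose_apply, Matrix.of_apply]
      rw [← h2, RCLike.inner_apply, conj_trivial]
      ring
    rw [norm_sq_sum_smul, Finset.mul_sum]
    simp only [dotProduct, Matrix.mulVec, Finset.mul_sum, hentry]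
    exact Finset.sum_congr rfl fun i _ => Finset.sum_congr rfl fun j _ => by ring
  have hnn : 0 ≤ lambdaMin (Xᵀ * X) := le_lambdaMin hn hXH fun v => by
    rw [hform, zero_mul]
    positivity
  refine le_lambdaMin hn (isHermitian_gramInfinity x)
    (mul_le_dotProduct_gramInfinity hnn fun u => ?_)
  rw [← hform]
  exact lambdaMin_mul_le hXH u


/-! ### Concentration for product measures -/

section Product

variable {Ω : Type*} [MeasurableSpace Ω] {ν : Measure Ω} [IsProbabilityMeasure ν] {m : ℕ}

theorem lintegral_pi_sum {f : Ω → ℝ≥0∞} (hf : Measurable f) :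
    ∫⁻ W, ∑ r, f (W r) ∂Measure.pi (fun _ : Fin m => ν) = m * ∫⁻ w, f w ∂ν := by
  rw [lintegral_finsetSum _ fun r _ => by fun_prop]
  have h : ∀ r, ∫⁻ W, f (W r) ∂Measure.pi (fun _ : Fin m => ν) = ∫⁻ w, f w ∂ν := fun r =>
    (measurePreserving_eval (fun _ : Fin m => ν) r).lintegral_comp hf
  simp [h]

/-- Chebyshev, with variances adding over independent coordinates. -/
theorem pi_abs_average_sub_integral_ge_le (hm : 0 < m) {h : Ω → ℝ} (hh : Measurable h) {D ε : ℝ}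
    (hD : ∀ ω, |h ω| ≤ D) (hε : 0 < ε) :
    Measure.pi (fun _ : Fin m => ν) {W | ε ≤ |1 / (m : ℝ) * ∑ r, h (W r) - ∫ ω, h ω ∂ν|} ≤
      ENNReal.ofReal (D ^ 2 / (m * ε ^ 2)) := by
  have hm' : (0 : ℝ) < m := Nat.cast_pos.2 hm
  set P := Measure.pi (fun _ : Fin m => ν)
  set X : (Fin m → Ω) → ℝ := ∑ r, fun W => h (W r) with hX
  have hXapp : ∀ W, X W = ∑ r, h (W r) := fun W => by rw [hX, Finset.sum_apply]
  have hmem : MemLp h 2 ν := MemLp.of_bound hh.aestronglyMeasurable D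
    (Filter.Eventually.of_forall hD)
  have hmemX : MemLp X 2 P := memLp_finsetSum' _ fun r _ =>
    hmem.comp_measurePreserving (measurePreserving_eval (fun _ : Fin m => ν) r)
  have hvar : Var[X; P] ≤ m * D ^ 2 := by
    rw [hX, variance_sum_pi fun _ => hmem]
    have h1 : Var[h; ν] ≤ D ^ 2 := by
      refine (variance_le_sq_of_bounded (a := -D) (b := D)
        (Filter.Eventually.of_forall fun ω => abs_le.1 (hD ω)) hh.aemeasurable).trans_eq ?_
      ring
    simpa using mul_le_mul_of_nonneg_left h1 hm'.le
  have hmean : P[X] = m * ∫ ω, h ω ∂ν := by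
    simp only [hXapp]
    have hint : ∀ r, Integrable (fun W => h (W r)) P := fun r => (hmem.comp_measurePreserving
      (measurePreserving_eval (fun _ : Fin m => ν) r)).integrable one_le_two
    rw [integral_finsetSum _ fun r _ => hint r]
    have h1 : ∀ r, ∫ W, h (W r) ∂P = ∫ ω, h ω ∂ν := fun r =>
      integral_comp_eval hh.aestronglyMeasurable
    simp [h1]
  have hcheb := meas_ge_le_variance_div_sq hmemX (c := m * ε) (by positivity)
  refine le_trans (measure_mono fun W hW => ?_) (hcheb.trans (ENNReal.ofReal_le_ofReal ?_))
  · simp only [Set.mem_ofPred_eq] at hW ⊢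
    rw [hmean, hXapp]
    have h1 : ∑ r, h (W r) - m * ∫ ω, h ω ∂ν =
        m * (1 / (m : ℝ) * ∑ r, h (W r) - ∫ ω, h ω ∂ν) := by
      field_simp
    rw [h1, abs_mul, abs_of_pos hm']
    gcongr
  · calc Var[X; P] / (m * ε) ^ 2 ≤ m * D ^ 2 / (m * ε) ^ 2 := by gcongr
      _ = D ^ 2 / (m * ε ^ 2) := by
        field_simp

/-- Markov's inequality for the sum; used for the fraction of near-kink neurons. -/
theorem pi_average_ge_le (hm : 0 < m) {h : Ω → ℝ} (hh : Measurable h) (h0 : ∀ ω, 0 ≤ h ω)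
    {p β : ℝ} (hp : ∫⁻ ω, ENNReal.ofReal (h ω) ∂ν ≤ ENNReal.ofReal p) (hβ : 0 < β) :
    Measure.pi (fun _ : Fin m => ν) {W | β ≤ 1 / (m : ℝ) * ∑ r, h (W r)} ≤
      ENNReal.ofReal (p / β) := by
  have hm' : (0 : ℝ) < m := Nat.cast_pos.2 hm
  have hmeas : Measurable fun W : Fin m → Ω => ∑ r, ENNReal.ofReal (h (W r)) := by fun_prop
  have hmar := mul_meas_ge_le_lintegral (μ := Measure.pi (fun _ : Fin m => ν)) hmeas
    (ENNReal.ofReal (m * β))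
  rw [lintegral_pi_sum (f := fun ω => ENNReal.ofReal (h ω)) (by fun_prop)] at hmar
  have h1 : {W : Fin m → Ω | β ≤ 1 / (m : ℝ) * ∑ r, h (W r)} ⊆
      {W | ENNReal.ofReal (m * β) ≤ ∑ r, ENNReal.ofReal (h (W r))} := fun W hW => by
    simp only [Set.mem_ofPred_eq] at hW ⊢
    rw [← ENNReal.ofReal_sum_of_nonneg fun r _ => h0 _]
    refine ENNReal.ofReal_le_ofReal ?_
    have := mul_le_mul_of_nonneg_left hW hm'.le
    rwa [← mul_assoc, mul_one_div_cancel hm'.ne', one_mul] at this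
  refine (measure_mono h1).trans ?_
  have hc0 : ENNReal.ofReal (m * β) ≠ 0 := by simpa using ⟨hm.ne', hβ⟩
  rw [ENNReal.ofReal_div_of_pos hβ]
  rw [mul_comm, ← ENNReal.le_div_iff_mul_le (Or.inl hc0) (Or.inl ENNReal.ofReal_ne_top)] at hmar
  refine hmar.trans ?_
  rw [ENNReal.ofReal_mul hm'.le, ENNReal.ofReal_natCast,
    ENNReal.mul_div_mul_left _ _ (by simpa using hm.ne') (by simp)]
  gcongr

end Product

/-! ### The initialisation -/

instance : IsProbabilityMeasure uniformSign :=
  ⟨by simp [uniformSign, ENNReal.inv_two_add_inv_two]⟩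

theorem ae_uniformSign_sq : ∀ᵐ t ∂uniformSign, t ^ 2 = 1 := by
  have hs : MeasurableSet {t : ℝ | t ^ 2 = 1} := measurableSet_eq_fun (by fun_prop) (by fun_prop)
  rw [uniformSign, ae_add_measure_iff]
  constructor <;>
  · refine Measure.ae_smul_measure ?_ _
    rw [ae_dirac_iff hs]
    norm_num

theorem memLp_uniformSign (c : ℝ) : MemLp (fun t => t * c) 2 uniformSign := by
  refine MemLp.of_bound (by fun_prop) |c| ?_
  filter_upwards [ae_uniformSign_sq] with t ht
  rw [Real.norm_eq_abs, abs_mul, ← Real.sqrt_sq_eq_abs t, ht, Real.sqrt_one, one_mul]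

theorem integral_uniformSign : ∫ t, t ∂uniformSign = 0 := by
  have h : ∀ c : ℝ, Integrable (fun t : ℝ => t) ((2⁻¹ : ℝ≥0∞) • Measure.dirac c) := fun c =>
    (integrable_dirac (by simp)).smul_measure (by simp)
  rw [uniformSign, integral_add_measure (h 1) (h (-1)), integral_smul_measure,
    integral_smul_measure]
  simp

theorem variance_uniformSign_le (c : ℝ) : Var[fun t => t * c; uniformSign] ≤ c ^ 2 := by
  rw [variance_mul_const]
  have h : Var[fun t => t; uniformSign] ≤ ((1 - (-1)) / 2) ^ 2 := by
    refine variance_le_sq_of_bounded ?_ (by fun_prop)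
    filter_upwards [ae_uniformSign_sq] with t ht
    constructor <;> nlinarith
  nlinarith [sq_nonneg c]

theorem lintegral_sum_sign_mul_sq_le {m : ℕ} (c : Fin m → ℝ) :
    ∫⁻ a, ENNReal.ofReal ((∑ r, a r * c r) ^ 2) ∂Measure.pi (fun _ : Fin m => uniformSign) ≤
      ∑ r, ENNReal.ofReal (c r ^ 2) := by
  set P := Measure.pi (fun _ : Fin m => uniformSign)
  set X : (Fin m → ℝ) → ℝ := ∑ r, fun a => a r * c r with hX
  have hXapp : ∀ a, X a = ∑ r, a r * c r := fun a => by rw [hX, Finset.sum_apply]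
  have hmemr : ∀ r, MemLp (fun a : Fin m → ℝ => a r * c r) 2 P := fun r =>
    (memLp_uniformSign (c r)).comp_measurePreserving
      (measurePreserving_eval (fun _ : Fin m => uniformSign) r)
  have hmemX : MemLp X 2 P := memLp_finsetSum' _ fun r _ => hmemr r
  have hmean : P[X] = 0 := by
    simp only [hXapp]
    rw [integral_finsetSum _ fun r _ => (hmemr r).integrable one_le_two]
    refine Finset.sum_eq_zero fun r _ => ?_
    have h1 : ∫ a, a r * c r ∂P = ∫ t, t * c r ∂uniformSign :=
      integral_comp_eval (μ := fun _ : Fin m => uniformSign) (f := fun t => t * c r) (by fun_prop)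
    rw [h1, integral_mul_const, integral_uniformSign, zero_mul]
  have hv : Var[X; P] ≤ ∑ r, c r ^ 2 := by
    rw [hX, variance_sum_pi (X := fun r t => t * c r) fun r => memLp_uniformSign (c r)]
    exact Finset.sum_le_sum fun r _ => variance_uniformSign_le (c r)
  have h := hmemX.ofReal_variance_eq
  rw [evariance_eq_lintegral_ofReal, hmean] at h
  simp only [hXapp, sub_zero] at h
  rw [← h, ← ENNReal.ofReal_sum_of_nonneg fun r _ => sq_nonneg _]
  exact ENNReal.ofReal_le_ofReal hv

section Init

variable {E : Type*} [NormedAddCommGroup E] [InnerProductSpace ℝ E] [FiniteDimensional ℝ E]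
  [MeasurableSpace E] [BorelSpace E] {m n : ℕ}

instance : IsProbabilityMeasure (initLaw E m) := by
  unfold initLaw
  infer_instance

theorem measurable_twoLayerNet (v : E) :
    Measurable fun p : (Fin m → E) × (Fin m → ℝ) => twoLayerNet p.1 p.2 v := by
  unfold twoLayerNet relu
  fun_prop

theorem measurable_sqError (x : Fin n → E) (y : Fin n → ℝ) :
    Measurable fun p : (Fin m → E) × (Fin m → ℝ) => sqError x y p.2 p.1 := by
  unfold sqError
  have h := fun i => measurable_twoLayerNet (m := m) (x i)
  fun_prop

/-- For fixed weights, integrating over the independent centred signs removes the cross terms. What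
remains is an average of `relu²`, so the bound does not grow with `m`. -/
theorem lintegral_twoLayerNet_sq_le (hm : 0 < m) (v : E) :
    ∫⁻ p, ENNReal.ofReal (twoLayerNet p.1 p.2 v ^ 2) ∂initLaw E m ≤ ENNReal.ofReal (‖v‖ ^ 2) := by
  have hm' : (m : ℝ≥0∞) ≠ 0 := by simpa using hm.ne'
  have hmeas : Measurable fun w : E => ENNReal.ofReal (relu (inner ℝ w v) ^ 2) := by
    unfold relu
    fun_prop
  rw [initLaw, lintegral_prod _ (by
    have := measurable_twoLayerNet (m := m) v
    fun_prop)]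
  have hinner : ∀ W : Fin m → E, ∫⁻ a, ENNReal.ofReal (twoLayerNet W a v ^ 2)
      ∂Measure.pi (fun _ : Fin m => uniformSign) ≤
      (m : ℝ≥0∞)⁻¹ * ∑ r, ENNReal.ofReal (relu (inner ℝ (W r) v) ^ 2) := fun W => by
    have h1 : ∀ a : Fin m → ℝ, ENNReal.ofReal (twoLayerNet W a v ^ 2) =
        (m : ℝ≥0∞)⁻¹ * ENNReal.ofReal ((∑ r, a r * relu (inner ℝ (W r) v)) ^ 2) := fun a => by
      rw [twoLayerNet, mul_pow, div_pow, Real.sq_sqrt (Nat.cast_nonneg m), one_pow, one_div,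
        ENNReal.ofReal_mul (by positivity), ENNReal.ofReal_inv_of_pos (Nat.cast_pos.2 hm),
        ENNReal.ofReal_natCast]
    simp only [h1]
    rw [lintegral_const_mul _ (by fun_prop)]
    gcongr
    exact lintegral_sum_sign_mul_sq_le _
  refine (lintegral_mono hinner).trans ?_
  rw [lintegral_const_mul _ (by unfold relu; fun_prop),
    lintegral_pi_sum (f := fun w => ENNReal.ofReal (relu (inner ℝ w v) ^ 2)) hmeas, ← mul_assoc,
    ENNReal.inv_mul_cancel hm' (by simp), one_mul]
  exact lintegral_relu_sq_le v

theorem lintegral_sqError_le (hm : 0 < m) {x : Fin n → E} {y : Fin n → ℝ} {M C : ℝ}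
    (hM : ∀ i, ‖x i‖ ≤ M) (hC : ∀ i, |y i| ≤ C) :
    ∫⁻ p, ENNReal.ofReal (sqError x y p.2 p.1) ∂initLaw E m ≤
      ENNReal.ofReal (n * (2 * M ^ 2 + 2 * C ^ 2)) := by
  have hnet := fun i => measurable_twoLayerNet (m := m) (x i)
  have hpt : ∀ p : (Fin m → E) × (Fin m → ℝ), ENNReal.ofReal (sqError x y p.2 p.1) ≤
      ∑ i, (2 * ENNReal.ofReal (twoLayerNet p.1 p.2 (x i) ^ 2) + ENNReal.ofReal (2 * C ^ 2)) := by
    intro p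
    rw [sqError, ENNReal.ofReal_sum_of_nonneg fun i _ => sq_nonneg _]
    refine Finset.sum_le_sum fun i _ => ?_
    rw [← ENNReal.ofReal_ofNat 2, ← ENNReal.ofReal_mul zero_le_two,
      ← ENNReal.ofReal_add (by positivity) (by positivity)]
    refine ENNReal.ofReal_le_ofReal ?_
    have h1 : y i ^ 2 ≤ C ^ 2 := sq_le_sq.2 ((hC i).trans (le_abs_self C))
    nlinarith [sq_nonneg (twoLayerNet p.1 p.2 (x i) + y i)]
  refine (lintegral_mono hpt).trans ?_
  rw [lintegral_finsetSum _ fun i _ => by fun_prop]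
  have hterm : ∀ i, ∫⁻ p, (2 * ENNReal.ofReal (twoLayerNet p.1 p.2 (x i) ^ 2) +
      ENNReal.ofReal (2 * C ^ 2)) ∂initLaw E m ≤ ENNReal.ofReal (2 * M ^ 2 + 2 * C ^ 2) := fun i => by
    rw [lintegral_add_right _ measurable_const, lintegral_const_mul _ (by fun_prop)]
    simp only [lintegral_const, measure_univ, mul_one]
    rw [ENNReal.ofReal_add (by positivity) (by positivity), ENNReal.ofReal_mul (q := M ^ 2) zero_le_two,
      ENNReal.ofReal_ofNat]
    gcongr
    refine (lintegral_twoLayerNet_sq_le hm (x i)).trans (ENNReal.ofReal_le_ofReal ?_)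
    gcongr
    exact hM i
  refine (Finset.sum_le_sum fun i _ => hterm i).trans_eq ?_
  rw [Finset.sum_const, Finset.card_univ, Fintype.card_fin, nsmul_eq_mul,
    ENNReal.ofReal_mul (Nat.cast_nonneg n), ENNReal.ofReal_natCast]

theorem initLaw_sqError_ge_le (hm : 0 < m) {x : Fin n → E} {y : Fin n → ℝ} {M C N : ℝ}
    (hM : ∀ i, ‖x i‖ ≤ M) (hC : ∀ i, |y i| ≤ C) (hN : 0 < N) :
    initLaw E m {p | N ≤ sqError x y p.2 p.1} ≤
      ENNReal.ofReal (n * (2 * M ^ 2 + 2 * C ^ 2) / N) := by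
  have h := (mul_meas_ge_le_lintegral (μ := initLaw E m)
    (measurable_sqError x y).ennreal_ofReal (ENNReal.ofReal N)).trans (lintegral_sqError_le hm hM hC)
  rw [ENNReal.ofReal_div_of_pos hN, ENNReal.le_div_iff_mul_le (Or.inl (by simpa using hN))
    (Or.inl ENNReal.ofReal_ne_top), mul_comm]
  refine le_trans ?_ h
  gcongr with p
  exact fun hp => ENNReal.ofReal_le_ofReal hp

theorem initLaw_fst {S : Set (Fin m → E)} (hS : MeasurableSet S) :
    initLaw E m {p | p.1 ∈ S} = Measure.pi (fun _ => stdGaussian E) S :=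
  (measurePreserving_fst (μ := Measure.pi fun _ : Fin m => stdGaussian E)
    (ν := Measure.pi fun _ : Fin m => uniformSign)).measure_preimage hS.nullMeasurableSet

theorem ae_initLaw_sign_sq : ∀ᵐ p ∂initLaw E m, ∀ r, p.2 r ^ 2 = 1 := by
  rw [ae_all_iff]
  intro r
  have h1 : ∀ᵐ a ∂Measure.pi (fun _ : Fin m => uniformSign), a r ^ 2 = 1 :=
    (measurePreserving_eval (fun _ : Fin m => uniformSign) r).quasiMeasurePreserving.ae
      ae_uniformSign_sq
  exact (measurePreserving_snd (μ := Measure.pi fun _ : Fin m => stdGaussian E)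
    (ν := Measure.pi fun _ : Fin m => uniformSign)).quasiMeasurePreserving.ae h1

end Init


/-! ### Probability of a good initialisation, and the choice of parameters. -/

section Main

variable {E : Type*} [NormedAddCommGroup E] [InnerProductSpace ℝ E] [FiniteDimensional ℝ E]
  [MeasurableSpace E] [BorelSpace E] {m n : ℕ}

/-- The initialisations from which gradient flow provably converges. -/
def goodInit (m : ℕ) (x : Fin n → E) (y : Fin n → ℝ) (ε β R N : ℝ) :
    Set ((Fin m → E) × (Fin m → ℝ)) :=
  {p | (∀ i j, |kernelMatrix x (fun r i => activation (p.1 r) (x i)) i j - gramInfinity x i j| < ε) ∧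
    (∀ i, 1 / (m : ℝ) * ∑ r, nearKink R (p.1 r) (x i) < β) ∧
    sqError x y p.2 p.1 < N ∧ ∀ r, p.2 r ^ 2 = 1}

theorem measurable_kernelMatrix_activation (x : Fin n → E) (i j : Fin n) :
    Measurable fun W : Fin m → E => kernelMatrix x (fun r i => activation (W r) (x i)) i j := by
  simp only [kernelMatrix, Matrix.of_apply]
  refine (Finset.measurable_sum _ fun r _ => ?_).const_mul _
  exact (measurable_activation_mul x i j).comp (measurable_pi_apply r)

theorem measurable_sum_nearKink (R : ℝ) (v : E) :
    Measurable fun W : Fin m → E => 1 / (m : ℝ) * ∑ r, nearKink R (W r) v := by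
  refine (Finset.measurable_sum _ fun r _ => ?_).const_mul _
  exact (measurable_nearKink R v).comp (measurable_pi_apply r)

theorem measurableSet_goodInit (x : Fin n → E) (y : Fin n → ℝ) (ε β R N : ℝ) :
    MeasurableSet (goodInit m x y ε β R N) := by
  have hk := measurable_kernelMatrix_activation (m := m) x
  have hn := fun i => measurable_sum_nearKink (m := m) R (x i)
  have hs := measurable_sqError (m := m) x y
  have heq : goodInit m x y ε β R N =
      (⋂ i, ⋂ j, {p | |kernelMatrix x (fun r i => activation (p.1 r) (x i)) i j -
        gramInfinity x i j| < ε}) ∩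
      ((⋂ i, {p | 1 / (m : ℝ) * ∑ r, nearKink R (p.1 r) (x i) < β}) ∩
      ({p | sqError x y p.2 p.1 < N} ∩ ⋂ r, {p | p.2 r ^ 2 = 1})) := by
    ext p
    simp only [goodInit, Set.mem_ofPred_eq, Set.mem_inter_iff, Set.mem_iInter]
  rw [heq]
  refine MeasurableSet.inter ?_ (MeasurableSet.inter ?_ (MeasurableSet.inter ?_ ?_))
  · refine MeasurableSet.iInter fun i => MeasurableSet.iInter fun j => ?_
    exact measurableSet_lt (((hk i j).comp measurable_fst).sub_const _).abs measurable_const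
  · refine MeasurableSet.iInter fun i => ?_
    exact measurableSet_lt ((hn i).comp measurable_fst) measurable_const
  · exact measurableSet_lt hs measurable_const
  · refine MeasurableSet.iInter fun r => ?_
    exact measurableSet_eq_fun (by fun_prop) measurable_const

/-- Union bound: Chebyshev for `n²` kernel entries, Markov for `n` near-kink fractions and for the
initial error; the sign condition holds almost surely. -/
theorem initLaw_compl_goodInit_le (hm : 0 < m) {x : Fin n → E} {y : Fin n → ℝ} {ε β R N M C : ℝ}
    (hx : ∀ i, x i ≠ 0) (hM : ∀ i, ‖x i‖ ≤ M) (hC : ∀ i, |y i| ≤ C) (hε : 0 < ε) (hβ : 0 < β)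
    (hN : 0 < N) :
    initLaw E m (goodInit m x y ε β R N)ᶜ ≤
      n * (n * ENNReal.ofReal ((M ^ 2) ^ 2 / (m * ε ^ 2))) + n * ENNReal.ofReal (R / β) +
        ENNReal.ofReal (n * (2 * M ^ 2 + 2 * C ^ 2) / N) := by
  set A : Fin n → Fin n → Set (Fin m → E) := fun i j =>
    {W | ε ≤ |kernelMatrix x (fun r i => activation (W r) (x i)) i j - gramInfinity x i j|}
  set B : Fin n → Set (Fin m → E) := fun i =>
    {W | β ≤ 1 / (m : ℝ) * ∑ r, nearKink R (W r) (x i)}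
  set D : Set ((Fin m → E) × (Fin m → ℝ)) := {p | N ≤ sqError x y p.2 p.1}
  set Z : Set ((Fin m → E) × (Fin m → ℝ)) := {p | ¬∀ r, p.2 r ^ 2 = 1}
  have hsub : (goodInit m x y ε β R N)ᶜ ⊆
      (⋃ i, ⋃ j, {p | p.1 ∈ A i j}) ∪ (⋃ i, {p | p.1 ∈ B i}) ∪ D ∪ Z := by
    intro p hp
    by_contra hcon
    simp only [Set.mem_union, Set.mem_iUnion, not_or, not_exists] at hcon
    obtain ⟨⟨⟨h1, h2⟩, h3⟩, h4⟩ := hcon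
    exact hp ⟨fun i j => not_le.1 (h1 i j), fun i => not_le.1 (h2 i), not_le.1 h3, not_not.1 h4⟩
  have hA : ∀ i j, initLaw E m {p | p.1 ∈ A i j} ≤
      ENNReal.ofReal ((M ^ 2) ^ 2 / (m * ε ^ 2)) := fun i j => by
    rw [initLaw_fst (measurableSet_le measurable_const
      ((measurable_kernelMatrix_activation x i j).sub_const _).abs)]
    have h := pi_abs_average_sub_integral_ge_le (ν := stdGaussian E) hm
      (measurable_activation_mul x i j) (fun w => abs_activation_mul_le hM w i j) hε
    rw [← gramInfinity_apply] at h
    exact h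
  have hB : ∀ i, initLaw E m {p | p.1 ∈ B i} ≤ ENNReal.ofReal (R / β) := fun i => by
    rw [initLaw_fst (measurableSet_le measurable_const (measurable_sum_nearKink R (x i)))]
    exact pi_average_ge_le hm (measurable_nearKink R (x i)) (fun w => nearKink_nonneg R w (x i))
      (lintegral_nearKink_le (hx i) R) hβ
  have hZ : initLaw E m Z = 0 := ae_initLaw_sign_sq
  calc initLaw E m (goodInit m x y ε β R N)ᶜ
      ≤ initLaw E m ((⋃ i, ⋃ j, {p | p.1 ∈ A i j}) ∪ (⋃ i, {p | p.1 ∈ B i}) ∪ D ∪ Z) :=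
        measure_mono hsub
    _ ≤ initLaw E m (⋃ i, ⋃ j, {p | p.1 ∈ A i j}) + initLaw E m (⋃ i, {p | p.1 ∈ B i}) +
          initLaw E m D + initLaw E m Z :=
        (measure_union_le _ _).trans (by
          gcongr
          exact (measure_union_le _ _).trans (by gcongr; exact measure_union_le _ _))
    _ ≤ (∑ i : Fin n, ∑ j : Fin n, ENNReal.ofReal ((M ^ 2) ^ 2 / (m * ε ^ 2))) +
          (∑ i : Fin n, ENNReal.ofReal (R / β)) +
          ENNReal.ofReal (n * (2 * M ^ 2 + 2 * C ^ 2) / N) + 0 := by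
        rw [hZ]
        gcongr
        · refine (measure_iUnion_fintype_le _ _).trans (Finset.sum_le_sum fun i _ => ?_)
          exact (measure_iUnion_fintype_le _ _).trans (Finset.sum_le_sum fun j _ => hA i j)
        · exact (measure_iUnion_fintype_le _ _).trans (Finset.sum_le_sum fun i _ => hB i)
        · exact initLaw_sqError_ge_le hm hM hC hN
    _ = _ := by simp

/-- The over-parameterisation constant for samples of norm at most `M` and labels bounded
by `C`. -/
noncomputable def widthConst (M C : ℝ) : ℝ :=
  48 * M ^ 8 + 6912 * M ^ 6 * (2 * M ^ 2 + 2 * C ^ 2) + 1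

theorem widthConst_pos (M C : ℝ) : 0 < widthConst M C := by
  have h1 : 0 ≤ M ^ 8 := by positivity
  have h2 : 0 ≤ M ^ 6 := by positivity
  unfold widthConst
  positivity

/-- The two demands on the width: the first makes the kernel concentrate, the second keeps the drift
below `R`. The first is weaker in `n`, `lam` and `δ`, and `lam² ≤ M⁴` brings it to the common form.
-/
theorem width_bounds {n m M C lam δ : ℝ} (hn : 1 ≤ n) (hlam : 0 < lam) (hlamM : lam ≤ M ^ 2)
    (hδ : 0 < δ) (hδ1 : δ < 1) (hm : widthConst M C * (n ^ 6 / (lam ^ 4 * δ ^ 6)) ≤ m) :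
    48 * n ^ 4 * M ^ 4 / (lam ^ 2 * δ) ≤ m ∧
      6912 * M ^ 6 * (2 * M ^ 2 + 2 * C ^ 2) * n ^ 6 / (lam ^ 4 * δ ^ 3) ≤ m := by
  have hM8 : 0 ≤ M ^ 8 := by positivity
  have hM6 : 0 ≤ M ^ 6 := by positivity
  have hZ : 0 ≤ n ^ 6 / (lam ^ 4 * δ ^ 6) := by positivity
  constructor
  · have h1 : 48 * M ^ 8 * (n ^ 6 / (lam ^ 4 * δ ^ 6)) ≤ m := by
      refine le_trans ?_ hm
      gcongr
      unfold widthConst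
      have : 0 ≤ 6912 * M ^ 6 * (2 * M ^ 2 + 2 * C ^ 2) := by positivity
      linarith
    refine le_trans ?_ h1
    rw [← mul_div_assoc, div_le_div_iff₀ (by positivity) (by positivity)]
    have h2 : lam ^ 2 ≤ M ^ 4 := by
      calc lam ^ 2 ≤ (M ^ 2) ^ 2 := by gcongr
        _ = M ^ 4 := by ring
    have h3 : δ ^ 5 ≤ 1 := pow_le_one₀ hδ.le hδ1.le
    have h4 : n ^ 4 ≤ n ^ 6 := pow_le_pow_right₀ hn (by norm_num)
    have hM4 : 0 ≤ M ^ 4 := by positivity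
    calc 48 * n ^ 4 * M ^ 4 * (lam ^ 4 * δ ^ 6)
        = 48 * M ^ 4 * (lam ^ 2 * δ) * (n ^ 4 * (lam ^ 2 * δ ^ 5)) := by ring
      _ ≤ 48 * M ^ 4 * (lam ^ 2 * δ) * (n ^ 6 * (M ^ 4 * 1)) := by gcongr
      _ = 48 * M ^ 8 * n ^ 6 * (lam ^ 2 * δ) := by ring
  · have h1 : 6912 * M ^ 6 * (2 * M ^ 2 + 2 * C ^ 2) * (n ^ 6 / (lam ^ 4 * δ ^ 6)) ≤ m := by
      refine le_trans ?_ hm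
      gcongr
      unfold widthConst
      linarith
    refine le_trans ?_ h1
    rw [mul_div_assoc]
    have h2 : δ ^ 6 ≤ δ ^ 3 := pow_le_pow_of_le_one hδ.le hδ1.le (by norm_num)
    gcongr

/-- With high probability over the initialisation, gradient flow on a sufficiently wide two-layer
network converges at the rate of the smallest eigenvalue of the Gram matrix. -/
theorem exists_good_initialisation {x : Fin n → E} {y : Fin n → ℝ} {M C δ : ℝ} (hn : 0 < n)
    (hM : ∀ i, ‖x i‖ ≤ M) (hC : ∀ i, |y i| ≤ C) (hδ : 0 < δ) (hδ1 : δ < 1)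
    (hlam : 0 < lambdaMin (gramInfinity x))
    (hm : widthConst M C * ((n : ℝ) ^ 6 / (lambdaMin (gramInfinity x) ^ 4 * δ ^ 6)) ≤ m) :
    ∃ good : Set ((Fin m → E) × (Fin m → ℝ)), MeasurableSet good ∧
      ENNReal.ofReal (1 - δ) ≤ initLaw E m good ∧
      ∀ W₀ a, (W₀, a) ∈ good → ∀ W : ℝ → Fin m → E, IsGradientFlow x y a W → W 0 = W₀ →
        ∀ t : ℝ, 0 ≤ t → sqError x y a (W t) ≤
          Real.exp (-(lambdaMin (gramInfinity x) * t)) * sqError x y a (W 0) := by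
  set lam := lambdaMin (gramInfinity x) with hlam_def
  have hn1 : (1 : ℝ) ≤ n := Nat.one_le_cast.2 hn
  have hn0 : (0 : ℝ) < n := by linarith
  have hlamM : lam ≤ M ^ 2 := (lambdaMin_gramInfinity_le hM ⟨0, hn⟩).1
  have hM0 : 0 < M := by
    have h0 : 0 ≤ M := (norm_nonneg _).trans (hM ⟨0, hn⟩)
    refine h0.lt_of_ne fun h => ?_
    rw [← h] at hlamM
    linarith
  have hx : ∀ i, x i ≠ 0 := fun i h => by
    have := (lambdaMin_gramInfinity_le hM i).2
    rw [h, norm_zero] at this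
    linarith
  have hmpos : (0 : ℝ) < m := by
    refine lt_of_lt_of_le ?_ hm
    have := widthConst_pos M C
    positivity
  have hm0 : 0 < m := Nat.cast_pos.1 hmpos
  obtain ⟨hw1, hw2⟩ := width_bounds hn1 hlam hlamM hδ hδ1 hm
  have hB : 0 < 2 * M ^ 2 + 2 * C ^ 2 := by positivity
  set b := 2 * M ^ 2 + 2 * C ^ 2 with hb
  -- `ε` and `β` are the tolerances of `kernelMatrix_coercive`. `R` is chosen so that `R / β = δ /
  -- (3 n)`, and `N` so that Markov fails with probability at most `δ / 3`; each kind of bad event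
  -- then costs at most `δ / 3`.
  set ε := lam / (4 * n) with hε
  set β := lam / (8 * M ^ 2 * n) with hβ
  set R := lam * δ / (24 * M ^ 2 * n ^ 2) with hR
  set N := 3 * n * b / δ with hN
  have hε0 : 0 < ε := by positivity
  have hβ0 : 0 < β := by positivity
  have hN0 : 0 < N := by positivity
  refine ⟨goodInit m x y ε β R N, measurableSet_goodInit x y ε β R N, ?_, ?_⟩
  · have hbad := initLaw_compl_goodInit_le hm0 (R := R) hx hM hC hε0 hβ0 hN0
    have e1 : (M ^ 2) ^ 2 / (m * ε ^ 2) ≤ δ / (3 * n ^ 2) := by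
      rw [div_le_div_iff₀ (by positivity) (by positivity), hε]
      rw [div_le_iff₀ (by positivity)] at hw1
      calc (M ^ 2) ^ 2 * (3 * n ^ 2) = 48 * n ^ 4 * M ^ 4 / (16 * n ^ 2) := by
            field_simp
            ring
        _ ≤ m * (lam ^ 2 * δ) / (16 * n ^ 2) := by gcongr
        _ = δ * (m * (lam / (4 * n)) ^ 2) := by
            field_simp
            ring
    have e2 : R / β = δ / (3 * n) := by
      rw [hR, hβ]
      field_simp
      ring
    have e3 : n * b / N = δ / 3 := by
      rw [hN]
      field_simp
    have hbad' : initLaw E m (goodInit m x y ε β R N)ᶜ ≤ ENNReal.ofReal δ := by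
      refine hbad.trans ?_
      rw [e2, e3]
      calc _ ≤ (n : ℝ≥0∞) * (n * ENNReal.ofReal (δ / (3 * n ^ 2))) +
            n * ENNReal.ofReal (δ / (3 * n)) + ENNReal.ofReal (δ / 3) := by gcongr
        _ = ENNReal.ofReal δ := by
          rw [← ENNReal.ofReal_natCast n, ← ENNReal.ofReal_mul hn0.le,
            ← ENNReal.ofReal_mul hn0.le, ← ENNReal.ofReal_mul hn0.le,
            ← ENNReal.ofReal_add (by positivity) (by positivity),
            ← ENNReal.ofReal_add (by positivity) (by positivity)]
          congr 1
          field_simp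
          ring
    have hgood := prob_compl_eq_one_sub (μ := initLaw E m)
      (measurableSet_goodInit (m := m) x y ε β R N).compl
    rw [compl_compl] at hgood
    rw [hgood, ENNReal.ofReal_sub _ hδ.le, ENNReal.ofReal_one]
    gcongr
  · rintro W₀ a ⟨hconc, hkink, herr, ha⟩ W hW rfl t ht
    refine sqError_le_exp_of_isGradientFlow (R := R) ha hW hlam hM0.le hM hm0 ?_ ?_ ht
    · intro W' s' hW' hs' v
      exact kernelMatrix_coercive (isHermitian_gramInfinity x) le_rfl hn hM0 hM
        (fun i j => (hconc i j).le) (fun i => (hkink i).le) hW' hs' v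
    -- Squared, the drift condition reads `4 M² n · error < m lam² R²`. Inserting `N` and `R` gives
    -- the constant `6912 = 12 · 576` of the second width bound.
    · refine lt_of_pow_lt_pow_left₀ 2 (by positivity) ?_
      have h1 : (2 * M * √n * √(sqError x y a (W 0))) ^ 2 =
          4 * M ^ 2 * n * sqError x y a (W 0) := by
        rw [mul_pow, mul_pow, mul_pow, Real.sq_sqrt hn0.le, Real.sq_sqrt (sqError_nonneg _ _ _ _)]
        ring
      have h2 : (√m * lam * R) ^ 2 = m * lam ^ 2 * R ^ 2 := by
        rw [mul_pow, mul_pow, Real.sq_sqrt hmpos.le]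
      rw [h1, h2]
      rw [div_le_iff₀ (by positivity)] at hw2
      calc 4 * M ^ 2 * n * sqError x y a (W 0) < 4 * M ^ 2 * n * N := by gcongr
        _ = 6912 * M ^ 6 * b * n ^ 6 * (1 / (576 * M ^ 4 * n ^ 4 * δ)) := by
            rw [hN]
            field_simp
            ring
        _ ≤ m * (lam ^ 4 * δ ^ 3) * (1 / (576 * M ^ 4 * n ^ 4 * δ)) := by gcongr
        _ = m * lam ^ 2 * R ^ 2 := by
            rw [hR]
            field_simp
            ring

end Main

theorem norm_output_sub_sq {w h n m : ℕ} (x : Fin n → FeatureSpace w h)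
    (W : Fin m → FeatureSpace w h) (a : Fin m → ℝ) (y : EuclideanSpace ℝ (Fin n)) :
    ‖output x W a - y‖ ^ 2 = sqError x y a W := by
  rw [EuclideanSpace.real_norm_sq_eq]
  rfl

theorem exp_mul_le_exp_mul {lam c t D : ℝ} (hc : c ≤ lam) (ht : 0 ≤ t) (hD : 0 ≤ D) :
    Real.exp (-(lam * t)) * D ≤ Real.exp (-(t * c)) * D := by
  have : t * c ≤ lam * t := by
    rw [mul_comm lam]
    gcongr
  gcongr

end CNN

theorem theorem3 (clow chigh C : ℝ) :
    ∃ K : ℝ, 0 < K ∧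
      ∀ (w h cin n p m : ℕ) (l : CNN.ConvLayer cin n p) (z : Fin cin → Fin w → Fin h → ℝ)
        (x : Fin n → CNN.FeatureSpace w h) (y : EuclideanSpace ℝ (Fin n)) (δ : ℝ),
        x = l.featureMap z →
        (∀ i, clow < ‖x i‖ ∧ ‖x i‖ < chigh) →
        (∀ i, |y i| < C) →
        0 < δ → δ < 1 →
        0 < CNN.lambdaMin (CNN.gramInfinity x) →
        K * ((n : ℝ) ^ 6 / (CNN.lambdaMin (CNN.gramInfinity x) ^ 4 * δ ^ 6)) ≤ m →
        ∃ good : Set ((Fin m → CNN.FeatureSpace w h) × (Fin m → ℝ)),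
          MeasurableSet good ∧
          ENNReal.ofReal (1 - δ) ≤ CNN.initLaw (CNN.FeatureSpace w h) m good ∧
          ∀ W₀ a, (W₀, a) ∈ good →
            ∀ W : ℝ → Fin m → CNN.FeatureSpace w h,
              CNN.IsGradientFlow x y a W → W 0 = W₀ →
              ∀ t : ℝ, 0 ≤ t →
                -- `X` is the matrix of the feature maps themselves
                (1 ≤ CNN.sigmaMax (CNN.scaledFeatureMatrix x) →
                  ‖CNN.output x (W t) a - y‖ ^ 2 ≤
                    Real.exp (-(t *
                      ((CNN.condNumber (CNN.scaledFeatureMatrix x) ^ 2)⁻¹).toReal)) *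
                      ‖CNN.output x (W 0) a - y‖ ^ 2) ∧
                -- `X` is any matrix whose singular values are the square roots of the eigenvalues
                -- of the Gram matrix because `Xᵀ X` equals it
                (∀ (q : ℕ) (X : Matrix (Fin q) (Fin n) ℝ),
                  X.transpose * X = CNN.gramInfinity x →
                  1 ≤ CNN.sigmaMax X →
                  ‖CNN.output x (W t) a - y‖ ^ 2 ≤
                    Real.exp (-(t * ((CNN.condNumber X ^ 2)⁻¹).toReal)) *
                      ‖CNN.output x (W 0) a - y‖ ^ 2) := by
  refine ⟨CNN.widthConst chigh C, CNN.widthConst_pos _ _, ?_⟩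
  intro w h cin n p m l z x y δ _ hx hy hδ hδ1 hlam hm
  have hn : 0 < n := by
    rcases Nat.eq_zero_or_pos n with rfl | hn
    -- For `n = 0` the spectrum is empty, so `lambdaMin` is `sInf ∅ = 0`, against its positivity.
    · simp [CNN.lambdaMin, spectrum.of_subsingleton] at hlam
    · exact hn
  obtain ⟨good, hgm, hgp, hg⟩ := CNN.exists_good_initialisation (m := m) (y := y) hn
    (fun i => (hx i).2.le) (fun i => (hy i).le) hδ hδ1 hlam hm
  refine ⟨good, hgm, hgp, fun W₀ a hmem W hW hW0 t ht => ?_⟩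
  have hmain := hg W₀ a hmem W hW hW0 t ht
  simp only [CNN.norm_output_sub_sq]
  -- Both claims weaken the rate from `lambdaMin` of the Gram matrix to `1/c²`.
  refine ⟨fun hmax => hmain.trans ?_, fun q X hX hmax => hmain.trans ?_⟩
  · exact CNN.exp_mul_le_exp_mul (CNN.toReal_inv_condNumber_sq_le hmax hlam.le
      (CNN.lambdaMin_scaledFeatureMatrix_le hn x)) ht (CNN.sqError_nonneg _ _ _ _)
  · exact CNN.exp_mul_le_exp_mul (CNN.toReal_inv_condNumber_sq_le hmax hlam.le
      (congrArg CNN.lambdaMin hX).le) ht (CNN.sqError_nonneg _ _ _ _)
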